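/- **Theorem 0.4 (operadic versions of the Artin–Wedderburn theorem).** Let $\Bbbk$ be a field. All operads are $\Bbbk$-linear, with operations $\mathcal P(n)$, $n\ge 0$, identity $\mathbb 1\in\mathcal P(1)$ and partial compositions $\circ_i:\mathcal P(m)\otimes\mathcal P(n)\to\mathcal P(m+n-1)$, $1\le i\le m$; a symmetric operad carries in addition compatible right actions of the symmetric groups $\mathbb S_n$ on $\mathcal P(n)$, a plain operad does not. $\mathcal P(1)$ is an algebra under $\circ_1$. A family $\mathcal I=(\mathcal I(n))_{n\ge0}$ of subspaces $\mathcal I(n)\subseteq\mathcal P(n)$ ($\mathbb S_n$-submodules in the symmetric case) is a right (resp. left) ideal if $\mathcal I\circ_i\mathcal P\subseteq\mathcal I$ (resp. $\mathcal P\circ_i\mathcal I\subseteq\mathcal I$) for all $i$, and an ideal if it is both. $\mathcal P$ is left (resp. right) artinian if its left (resp. right) ideals satisfy the descending chain condition, and semiprime if it has no ideal $\mathcal N\ne0$ with $\mathcal N^2=0$, where $\mathcal I\mathcal J$ is the family of subspaces ($\mathbb S_n$-submodules in the symmetric case) generated by all $\mu\circ_i\nu$ with $\mu\in\mathcal I,\nu\in\mathcal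 J$. $\mathcal P$ is reduced if $\mathcal P(0)=0$; unitary if $\mathcal P(0)=\Bbbk\mathbb 1_0$ is one-dimensional; bounded above if $\mathcal P(n)=0$ for $n\gg0$; 2-unitary if it is unitary and there is $\mathbb 1_2\in\mathcal P(2)$ with $\mathbb 1_2\circ_2\mathbb 1_0=\mathbb 1=\mathbb 1_2\circ_1\mathbb 1_0$. If $\mathcal P$ is locally finite (all $\dim\mathcal P(n)<\infty$), then $\operatorname{GKdim}\mathcal P=\limsup_{n\to\infty}\log_n\sum_{i=0}^n\dim_\Bbbk\mathcal P(i)$. For an augmented algebra $A=\Bbbk\oplus\bar A$ with augmentation ideal $\bar A$, $\mathcal D_A$ is the 2-unitary symmetric operad with $\mathcal D_A(n)=\Bbbk\mathbb 1_n\oplus\bigoplus_{i=1}^n\bar A_{(i)}$, where $\bar A_{(i)}=\{\delta^n_{(i)}:\delta\in\bar A\}$ is a copy of $\bar A$, with $\mathcal D_A(1)=A$, actions $\mathbb 1_n*\sigma=\mathbb 1_n$, $\delta^n_{(i)}*\sigma=\delta^n_{(\sigma^{-1}(i))}$, and partial compositions, for $m\ge1$, $n\ge0$ and $\delta,\delta'\in\bar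 A$, $$\mathbb 1_m\circ_i\mathbb 1_n=\mathbb 1_{m+n-1},\qquad \mathbb 1_m\circ_i\delta^n_{(q)}=\delta^{m+n-1}_{(q+i-1)},$$ $$\delta^m_{(s)}\circ_i\mathbb 1_n=\begin{cases}\delta^{m+n-1}_{(s)},& s<i,\\ \sum_{h=i}^{i+n-1}\delta^{m+n-1}_{(h)},& s=i,\\ \delta^{m+n-1}_{(s+n-1)},& s>i,\end{cases}\qquad \delta^m_{(s)}\circ_i\delta'^{\,n}_{(q)}=\begin{cases}(\delta\delta')^{m+n-1}_{(i+q-1)},& s=i,\\ 0,& s\ne i.\end{cases}$$ Let $\mathcal P$ be a semiprime operad that is left or right artinian. In (1) and (2) $\mathcal P$ is either a plain or a symmetric operad, in (3) $\mathcal P$ is a symmetric operad. (1) If $\mathcal P$ is reduced, then $\mathcal P(n)=0$ for all $n\neq1$, and $\mathcal P(1)$ is a semisimple algebra. (2) If $\mathcal P$ is unitary and bounded above, then $\mathcal P(0)\cong\Bbbk$, $\mathcal P(n)=0$ for all $n\ge2$, and $\mathcal P(1)$ is an augmented semisimple algebra, with augmentation $\varepsilon$ given by $a\circ_1\mathbb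 1_0=\varepsilon(a)\mathbb 1_0$. (3) If $\mathcal P$ is 2-unitary with $0$-unit $\mathbb 1_0$ and $2$-unit $\mathbb 1_2$, then $A=\mathcal P(1)$ is a semisimple algebra, augmented by $a\circ_1\mathbb 1_0=\varepsilon(a)\mathbb 1_0$, and $\mathcal P\cong\mathcal D_A$ as symmetric operads, by an isomorphism carrying $\mathbb 1_0$ and $\mathbb 1_2$ to the elements $\mathbb 1_0$ and $\mathbb 1_2$ of $\mathcal D_A$. If, further, $\mathcal P(1)$ is finite dimensional over $\Bbbk$, then $\mathcal P$ is locally finite, and either $\operatorname{GKdim}\mathcal P=2$, or $\operatorname{GKdim}\mathcal P=1$ and $\mathcal P\cong\mathrm{Com}$, where $\mathrm{Com}$ is the symmetric operad with $\mathrm{Com}(n)=\Bbbk$ for all $n\ge0$, compositions given by multiplication, and trivial actions. -/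

import Mathlib

universe u v w

/-! ### Operads over a field, in terms of partial compositions -/

/-- A `k`-linear plain (non-symmetric) operad, in the partial-composition presentation.
`circ h i a b` is the partial composition `a ∘ᵢ b` of `a ∈ P(m)` and `b ∈ P(n)`. Input slots are
numbered from `0`, and the arity `m + n - 1` of the result is any `r` with `m + n = r + 1`
(so no transport along equalities of natural numbers is needed).
`assoc_seq` is `(a ∘ᵢ b) ∘_{i-1+j} c = a ∘ᵢ (b ∘ⱼ c)`, and `assoc_par` is
`(a ∘ᵢ b) ∘_{j-1+m} c = (a ∘ⱼ c) ∘ᵢ b` for `i < j` (with slots numbered from `1`). -/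
structure PlainOperad (k : Type u) [Field k] where
  obj : ℕ → Type v
  [addCommGroup : ∀ n, AddCommGroup (obj n)]
  [module : ∀ n, Module k (obj n)]
  one : obj 1
  circ : ∀ {m n r : ℕ}, m + n = r + 1 → Fin m → (obj m →ₗ[k] obj n →ₗ[k] obj r)
  circ_one : ∀ {n : ℕ} (i : Fin n) (a : obj n), circ rfl i a one = a
  one_circ : ∀ {n : ℕ} (a : obj n), circ (Nat.add_comm 1 n) 0 one a = a
  assoc_seq : ∀ {l m n r s t : ℕ} (h₁ : l + m = r + 1) (h₂ : r + n = s + 1)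
    (h₃ : m + n = t + 1) (h₄ : l + t = s + 1) (i : Fin l) (j : Fin m) (p : Fin r),
    (p : ℕ) = i + j → ∀ (a : obj l) (b : obj m) (c : obj n),
      circ h₂ p (circ h₁ i a b) c = circ h₄ i a (circ h₃ j b c)
  assoc_par : ∀ {l m n r s t : ℕ} (h₁ : l + m = r + 1) (h₂ : r + n = s + 1)
    (h₃ : l + n = t + 1) (h₄ : t + m = s + 1) (i j : Fin l) (p : Fin r) (q : Fin t),
    i < j → (p : ℕ) + 1 = j + m → (q : ℕ) = i → ∀ (a : obj l) (b : obj m) (c : obj n),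
      circ h₂ p (circ h₁ i a b) c = circ h₄ q (circ h₃ j a c) b

attribute [instance] PlainOperad.addCommGroup PlainOperad.module

/-- The inputs of `a ∘ᵢ b` (`a` of arity `m`, `b` of arity `n`): they are the inputs of `a` other
than the `i`-th one, together with the inputs of `b`, which sit in the positions
`i, i + 1, …, i + n - 1`. -/
def slotEquiv {m n r : ℕ} (h : m + n = r + 1) (i : Fin m) :
    Fin r ≃ {x : Fin m // x ≠ i} ⊕ Fin n where
  toFun p :=
    if h₁ : (p : ℕ) < i then Sum.inl ⟨⟨p, by omega⟩, by simp [Fin.ext_iff]; omega⟩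
    else if h₂ : (p : ℕ) < i + n then Sum.inr ⟨p - i, by omega⟩
    else Sum.inl ⟨⟨p + 1 - n, by omega⟩, by simp [Fin.ext_iff]; omega⟩
  invFun := Sum.elim
    (fun x => if h₁ : (x.1 : ℕ) < i then ⟨x.1, by omega⟩
      else ⟨x.1 + n - 1, by have := x.2; have := x.1.2; simp [Fin.ext_iff] at *; omega⟩)
    (fun q => ⟨i + q, by omega⟩)
  left_inv p := by
    dsimp only
    split_ifs with h₁ h₂
    · rw [Sum.elim_inl, dif_pos h₁]
    · rw [Sum.elim_inr]
      exact Fin.ext (by simp only; omega)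
    · have h₃ : ¬ ((p : ℕ) + 1 - n < i) := by omega
      rw [Sum.elim_inl, dif_neg h₃]
      exact Fin.ext (by simp only; omega)
  right_inv x := by
    rcases x with ⟨x, hx⟩ | q
    · dsimp only [Sum.elim_inl]
      have h₄ : (x : ℕ) ≠ i := fun e => hx (Fin.ext e)
      by_cases h₁ : (x : ℕ) < i
      · simp only [dif_pos h₁]
      · have h₂ : ¬ ((x : ℕ) + n - 1 < i) := by omega
        have h₃ : ¬ ((x : ℕ) + n - 1 < i + n) := by omega
        simp only [dif_neg h₁, dif_neg h₂, dif_neg h₃]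
        exact congrArg Sum.inl (Subtype.ext (Fin.ext (by simp only; omega)))
    · simp

/-- The permutation `σ'` of the inputs of `a ∘ᵢ b` which permutes the `i`-th block, of size `n`, by
`σ` and fixes all other inputs. -/
def innerPerm {m n r : ℕ} (h : m + n = r + 1) (i : Fin m) (σ : Equiv.Perm (Fin n)) :
    Equiv.Perm (Fin r) :=
  (slotEquiv h i).trans (((Equiv.refl _).sumCongr σ).trans (slotEquiv h i).symm)

/-- The block permutation `σ''` induced by `σ` on the inputs of `a ∘ᵢ b`, where the `i`-th block has
size `n` and all other blocks have size `1`. -/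
def outerPerm {m n r : ℕ} (h : m + n = r + 1) (i : Fin m) (σ : Equiv.Perm (Fin m)) :
    Equiv.Perm (Fin r) :=
  (slotEquiv h i).trans
    (((σ.subtypeEquiv (fun x => by simp) : {x // x ≠ i} ≃ {x // x ≠ σ i}).sumCongr
      (Equiv.refl (Fin n))).trans (slotEquiv h (σ i)).symm)

/-- A `k`-linear (symmetric) operad: a plain operad with a right action `a ∗ σ = act σ a` of the
symmetric group on `P(n)` for each `n`, compatible with the partial compositions. -/
structure SymmOperad (k : Type u) [Field k] extends PlainOperad.{u, v} k where
  act : ∀ {n : ℕ}, Equiv.Perm (Fin n) → (obj n →ₗ[k] obj n)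
  act_one : ∀ {n : ℕ} (a : obj n), act 1 a = a
  act_mul : ∀ {n : ℕ} (σ τ : Equiv.Perm (Fin n)) (a : obj n), act (σ * τ) a = act τ (act σ a)
  circ_act : ∀ {m n r : ℕ} (h : m + n = r + 1) (i : Fin m) (σ : Equiv.Perm (Fin n))
    (a : obj m) (b : obj n), circ h i a (act σ b) = act (innerPerm h i σ) (circ h i a b)
  act_circ : ∀ {m n r : ℕ} (h : m + n = r + 1) (i : Fin m) (σ : Equiv.Perm (Fin m))
    (a : obj m) (b : obj n), circ h i (act σ a) b = act (outerPerm h i σ) (circ h (σ i) a b)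

namespace PlainOperad

variable {k : Type u} [Field k] (P : PlainOperad.{u, v} k)

/-! ### The algebra of unary operations -/

/-- The space `P(1)`, regarded as an algebra with multiplication `∘₁`. -/
def Unary : Type v := P.obj 1

instance : AddCommGroup P.Unary := inferInstanceAs (AddCommGroup (P.obj 1))

instance : Module k P.Unary := inferInstanceAs (Module k (P.obj 1))

instance : Mul P.Unary := ⟨fun a b => P.circ (r := 1) rfl 0 a b⟩

instance : One P.Unary := ⟨P.one⟩

lemma unary_mul_def (a b : P.Unary) : a * b = P.circ (m := 1) (n := 1) (r := 1) rfl 0 a b := rfl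

instance : Ring P.Unary :=
  { (inferInstance : AddCommGroup P.Unary), (inferInstance : Mul P.Unary),
    (inferInstance : One P.Unary) with
    left_distrib := fun a b c => map_add (P.circ (m := 1) (n := 1) (r := 1) rfl 0 a) b c
    right_distrib := fun a b c =>
      LinearMap.map_add₂ (P.circ (m := 1) (n := 1) (r := 1) rfl 0) a b c
    zero_mul := fun a => LinearMap.map_zero₂ (P.circ (m := 1) (n := 1) (r := 1) rfl 0) a
    mul_zero := fun a => map_zero (P.circ (m := 1) (n := 1) (r := 1) rfl 0 a)
    mul_assoc := fun a b c => P.assoc_seq (l := 1) (m := 1) (n := 1) rfl rfl rfl rfl 0 0 0 rfl a b c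
    one_mul := fun a => P.one_circ (n := 1) a
    mul_one := fun a => P.circ_one (n := 1) 0 a }

instance : Algebra k P.Unary :=
  Algebra.ofModule
    (fun c a b => LinearMap.map_smul₂ (P.circ (m := 1) (n := 1) (r := 1) rfl 0) c a b)
    (fun c a b => map_smul (P.circ (m := 1) (n := 1) (r := 1) rfl 0 a) c b)

/-! ### Reduced, unitary and 2-unitary operads, finiteness and growth -/

/-- `P(0) = 0`. -/
def IsReduced : Prop := Subsingleton (P.obj 0)

/-- `P(n) = 0` for all large `n`. -/
def IsBoundedAbove : Prop := ∃ N : ℕ, ∀ n ≥ N, Subsingleton (P.obj n)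

/-- `e₀` is a `0`-unit: a basis of `P(0)`. An operad is unitary if it has a `0`-unit. -/
def IsZeroUnit (e₀ : P.obj 0) : Prop := e₀ ≠ 0 ∧ ∀ x : P.obj 0, ∃ c : k, x = c • e₀

/-- `e₂` is a `2`-unit with respect to the `0`-unit `e₀`: `e₂ ∘ (1, e₀) = 1 = e₂ ∘ (e₀, 1)`. -/
def IsTwoUnit (e₀ : P.obj 0) (e₂ : P.obj 2) : Prop :=
  P.circ (m := 2) (n := 0) (r := 1) rfl 1 e₂ e₀ = P.one ∧
    P.circ (m := 2) (n := 0) (r := 1) rfl 0 e₂ e₀ = P.one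

/-- The augmentation of the algebra `P(1)` given by a `0`-unit: `a ∘₁ e₀ = ε(a) e₀`. -/
def IsAugmentation (e₀ : P.obj 0) (ε : P.Unary →ₐ[k] k) : Prop :=
  ∀ a : P.Unary, P.circ (m := 1) (n := 0) (r := 0) rfl 0 a e₀ = ε a • e₀

def IsLocallyFinite : Prop := ∀ n, Module.Finite k (P.obj n)

/-- The Gelfand–Kirillov dimension `limsup log_n (∑_{i ≤ n} dim P(i))` of a locally finite
operad. -/
noncomputable def gkDim : EReal :=
  Filter.limsup (fun n : ℕ =>
    ((Real.logb n (∑ i ∈ Finset.range (n + 1), (Module.finrank k (P.obj i) : ℝ)) : ℝ) : EReal))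
    Filter.atTop

/-! ### Ideals of plain operads -/

/-- Families of subspaces `I(n) ⊆ P(n)`, ordered componentwise. -/
abbrev Sub : Type v := ∀ n, Submodule k (P.obj n)

/-- A right ideal of a plain operad. -/
def IsRightIdeal (I : P.Sub) : Prop :=
  ∀ {m n r : ℕ} (h : m + n = r + 1) (i : Fin m) (a : P.obj m) (b : P.obj n),
    a ∈ I m → P.circ h i a b ∈ I r

/-- A left ideal of a plain operad. -/
def IsLeftIdeal (I : P.Sub) : Prop :=
  ∀ {m n r : ℕ} (h : m + n = r + 1) (i : Fin m) (a : P.obj m) (b : P.obj n),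
    b ∈ I n → P.circ h i a b ∈ I r

/-- A (two-sided) ideal of a plain operad. -/
def IsIdeal (I : P.Sub) : Prop := P.IsLeftIdeal I ∧ P.IsRightIdeal I

/-- Every descending chain of right ideals is eventually constant. -/
def IsRightArtinian : Prop :=
  ∀ f : ℕ → P.Sub, (∀ t, P.IsRightIdeal (f t)) → Antitone f → ∃ N, ∀ t ≥ N, f t = f N

/-- Every descending chain of left ideals is eventually constant. -/
def IsLeftArtinian : Prop :=
  ∀ f : ℕ → P.Sub, (∀ t, P.IsLeftIdeal (f t)) → Antitone f → ∃ N, ∀ t ≥ N, f t = f N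

/-- The product `I J`, spanned by all `a ∘ᵢ b` with `a ∈ I` and `b ∈ J`. -/
def prod (I J : P.Sub) : P.Sub := fun r =>
  Submodule.span k {x | ∃ (m n : ℕ) (h : m + n = r + 1) (i : Fin m) (a : P.obj m) (b : P.obj n),
    a ∈ I m ∧ b ∈ J n ∧ x = P.circ h i a b}

/-- There is no ideal `N ≠ 0` with `N² = 0`. -/
def IsSemiprime : Prop := ∀ N : P.Sub, P.IsIdeal N → N ≠ ⊥ → P.prod N N ≠ ⊥

end PlainOperad

namespace SymmOperad

variable {k : Type u} [Field k] (P : SymmOperad.{u, v} k)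

/-! ### Ideals of symmetric operads

All ideals are required to be stable under the symmetric group actions. -/

/-- `I(n)` is an `S_n`-submodule of `P(n)` for each `n`. -/
def IsSubmodule (I : P.Sub) : Prop :=
  ∀ {n : ℕ} (σ : Equiv.Perm (Fin n)) (a : P.obj n), a ∈ I n → P.act σ a ∈ I n

def IsRightIdeal (I : P.Sub) : Prop := P.IsSubmodule I ∧ P.toPlainOperad.IsRightIdeal I

def IsLeftIdeal (I : P.Sub) : Prop := P.IsSubmodule I ∧ P.toPlainOperad.IsLeftIdeal I

def IsIdeal (I : P.Sub) : Prop := P.IsLeftIdeal I ∧ P.IsRightIdeal I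

def IsRightArtinian : Prop :=
  ∀ f : ℕ → P.Sub, (∀ t, P.IsRightIdeal (f t)) → Antitone f → ∃ N, ∀ t ≥ N, f t = f N

def IsLeftArtinian : Prop :=
  ∀ f : ℕ → P.Sub, (∀ t, P.IsLeftIdeal (f t)) → Antitone f → ∃ N, ∀ t ≥ N, f t = f N

/-- The product `I J`: the family of `S_n`-submodules generated by all `a ∘ᵢ b` with `a ∈ I` and
`b ∈ J`, that is, the span of all `(a ∘ᵢ b) ∗ σ`. -/
def prod (I J : P.Sub) : P.Sub := fun r =>
  Submodule.span k {x | ∃ (m n : ℕ) (h : m + n = r + 1) (i : Fin m) (a : P.obj m) (b : P.obj n)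
    (σ : Equiv.Perm (Fin r)), a ∈ I m ∧ b ∈ J n ∧ x = P.act σ (P.circ h i a b)}

def IsSemiprime : Prop := ∀ N : P.Sub, P.IsIdeal N → N ≠ ⊥ → P.prod N N ≠ ⊥

/-! ### Isomorphisms, and the examples `Com` and `D_A` -/

/-- An isomorphism of symmetric operads. -/
structure Iso (P : SymmOperad.{u, v} k) (Q : SymmOperad.{u, w} k) where
  equiv : ∀ n, P.obj n ≃ₗ[k] Q.obj n
  map_one : equiv 1 P.one = Q.one
  map_circ : ∀ {m n r : ℕ} (h : m + n = r + 1) (i : Fin m) (a : P.obj m) (b : P.obj n),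
    equiv r (P.circ h i a b) = Q.circ h i (equiv m a) (equiv n b)
  map_act : ∀ {n : ℕ} (σ : Equiv.Perm (Fin n)) (a : P.obj n),
    equiv n (P.act σ a) = Q.act σ (equiv n a)

/-- The operad `Com` of unital commutative algebras: `Com(n) = k` for all `n ≥ 0`, with trivial
actions of the symmetric groups. -/
def com (k : Type u) [Field k] : SymmOperad.{u, u} k where
  obj _ := k
  one := (1 : k)
  circ _ _ := LinearMap.mul k k
  circ_one _ a := mul_one a
  one_circ a := one_mul a
  assoc_seq _ _ _ _ _ _ _ _ a b c := mul_assoc a b c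
  assoc_par _ _ _ _ _ _ _ _ _ _ _ a b c := mul_right_comm a b c
  act _ := LinearMap.id
  act_one _ := rfl
  act_mul _ _ _ := rfl
  circ_act _ _ _ _ _ := rfl
  act_circ _ _ _ _ _ := rfl

end SymmOperad

section Derivations

variable {k : Type u} [Field k] {A : Type v} [Ring A] [Algebra k A] (ε : A →ₐ[k] k)

/-- The augmentation ideal `Ā = ker ε` of an augmented algebra `(A, ε)`. -/
abbrev augIdeal : Submodule k A := LinearMap.ker ε.toLinearMap

/-- The multiplication of `Ā`. -/
def augMul (a b : augIdeal ε) : augIdeal ε := ⟨a * b, by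
  have := a.2
  simp only [LinearMap.mem_ker, AlgHom.toLinearMap_apply, map_mul] at this ⊢
  rw [this, zero_mul]⟩

/-- The composition `x ∘ᵢ y` in `D_A`, see `derivOperad`. -/
def derivCirc {m n r : ℕ} (h : m + n = r + 1) (i : Fin m)
    (x : k × (Fin m → augIdeal ε)) (y : k × (Fin n → augIdeal ε)) : k × (Fin r → augIdeal ε) :=
  (x.1 * y.1, fun p => Sum.elim
    (fun s => y.1 • x.2 s.1)
    (fun q => x.1 • y.2 q + y.1 • x.2 i + augMul ε (x.2 i) (y.2 q))
    (slotEquiv h i p))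

/-- Auxiliary: extension of a tuple by zero to all natural numbers. -/
def extZero {B : Type v} [Zero B] {m : ℕ} (f : Fin m → B) (x : ℕ) : B :=
  if h : x < m then f ⟨x, h⟩ else 0

lemma extZero_val {B : Type v} [Zero B] {m : ℕ} (f : Fin m → B) (x : Fin m) :
    extZero f x = f x := by
  simp [extZero]

lemma derivCirc_lt {m n r : ℕ} (h : m + n = r + 1) (i : Fin m)
    (x : k × (Fin m → augIdeal ε)) (y : k × (Fin n → augIdeal ε)) (p : ℕ) (hp : p < i) :
    extZero (derivCirc ε h i x y).2 p = y.1 • extZero x.2 p := by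
  have h₁ : p < r := by omega
  have h₂ : p < m := by omega
  simp [extZero, h₁, h₂, derivCirc, slotEquiv, hp]

lemma derivCirc_mid {m n r : ℕ} (h : m + n = r + 1) (i : Fin m)
    (x : k × (Fin m → augIdeal ε)) (y : k × (Fin n → augIdeal ε)) (p : ℕ) (hp : (i : ℕ) ≤ p)
    (hq : p < i + n) :
    extZero (derivCirc ε h i x y).2 p = x.1 • extZero y.2 (p - i) + y.1 • extZero x.2 i
      + augMul ε (extZero x.2 i) (extZero y.2 (p - i)) := by
  have h₁ : p < r := by omega
  have h₂ : p - i < n := by omega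
  simp [extZero, h₁, h₂, derivCirc, slotEquiv, hq, Nat.not_lt.mpr hp]

lemma derivCirc_ge {m n r : ℕ} (h : m + n = r + 1) (i : Fin m)
    (x : k × (Fin m → augIdeal ε)) (y : k × (Fin n → augIdeal ε)) (p : ℕ)
    (hp : (i : ℕ) + n ≤ p) (hr : p < r) :
    extZero (derivCirc ε h i x y).2 p = y.1 • extZero x.2 (p + 1 - n) := by
  have h₁ : ¬ (p < i) := by omega
  have h₂ : ¬ (p < i + n) := by omega
  have h₃ : p + 1 - n < m := by omega
  simp [extZero, hr, h₃, derivCirc, slotEquiv, h₁, h₂]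

lemma derivCirc_ext {m : ℕ} {x y : k × (Fin m → augIdeal ε)} (h : x.1 = y.1)
    (h' : ∀ p < m, extZero x.2 p = extZero y.2 p) : x = y := by
  refine Prod.ext h (funext fun p => ?_)
  simpa only [extZero_val] using h' p p.2

lemma derivCirc_seq {l m n r s t : ℕ} (h₁ : l + m = r + 1) (h₂ : r + n = s + 1)
    (h₃ : m + n = t + 1) (h₄ : l + t = s + 1) (i : Fin l) (j : Fin m) (p : Fin r)
    (hp : (p : ℕ) = i + j) (a : k × (Fin l → augIdeal ε)) (b : k × (Fin m → augIdeal ε))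
    (c : k × (Fin n → augIdeal ε)) :
    derivCirc ε h₂ p (derivCirc ε h₁ i a b) c = derivCirc ε h₄ i a (derivCirc ε h₃ j b c) := by
  refine derivCirc_ext ε (mul_assoc _ _ _) fun z hz => ?_
  have hj := j.2
  have hi := i.2
  rcases lt_or_ge z i with z₁ | z₁
  · rw [derivCirc_lt _ _ _ _ _ _ (by omega), derivCirc_lt _ _ _ _ _ _ (by omega),
      derivCirc_lt _ _ _ _ _ _ (by omega), smul_smul, mul_comm]
    rfl
  rcases lt_or_ge z (i + j) with z₂ | z₂
  · rw [derivCirc_lt _ _ _ _ _ _ (by omega), derivCirc_mid _ _ _ _ _ _ (by omega) (by omega),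
      derivCirc_mid _ _ _ _ _ _ (by omega) (by omega), derivCirc_lt _ _ _ _ _ _ (by omega)]
    refine Subtype.ext ?_
    simp [augMul, derivCirc]
    module
  rcases lt_or_ge z (i + j + n) with z₃ | z₃
  · rw [derivCirc_mid _ _ _ _ _ _ (by omega) (by omega),
      derivCirc_mid _ _ _ _ _ _ (by omega) (by omega),
      derivCirc_mid _ _ _ _ _ _ (by omega) (by omega),
      derivCirc_mid _ _ _ _ _ _ (by omega) (by omega),
      show (p : ℕ) - i = j by omega, show z - p = z - i - j by omega]
    refine Subtype.ext ?_
    simp [augMul, derivCirc, mul_add, add_mul, mul_assoc]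
    module
  rcases lt_or_ge z (i + t) with z₄ | z₄
  · rw [derivCirc_ge _ _ _ _ _ _ (by omega) (by omega),
      derivCirc_mid _ _ _ _ _ _ (by omega) (by omega),
      derivCirc_mid _ _ _ _ _ _ (by omega) (by omega),
      derivCirc_ge _ _ _ _ _ _ (by omega) (by omega),
      show z + 1 - n - i = z - i + 1 - n by omega]
    refine Subtype.ext ?_
    simp [augMul, derivCirc]
    module
  · rw [derivCirc_ge _ _ _ _ _ _ (by omega) (by omega),
      derivCirc_ge _ _ _ _ _ _ (by omega) (by omega),
      derivCirc_ge _ _ _ _ _ _ (by omega) (by omega), smul_smul, mul_comm,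
      show z + 1 - n + 1 - m = z + 1 - t by omega]
    rfl

lemma derivCirc_par {l m n r s t : ℕ} (h₁ : l + m = r + 1) (h₂ : r + n = s + 1)
    (h₃ : l + n = t + 1) (h₄ : t + m = s + 1) (i j : Fin l) (p : Fin r) (q : Fin t)
    (hij : i < j) (hp : (p : ℕ) + 1 = j + m) (hq : (q : ℕ) = i)
    (a : k × (Fin l → augIdeal ε)) (b : k × (Fin m → augIdeal ε))
    (c : k × (Fin n → augIdeal ε)) :
    derivCirc ε h₂ p (derivCirc ε h₁ i a b) c = derivCirc ε h₄ q (derivCirc ε h₃ j a c) b := by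
  refine derivCirc_ext ε (mul_right_comm _ _ _) fun z hz => ?_
  have hj := j.2
  have hi := i.2
  have hij' : (i : ℕ) < j := hij
  rcases lt_or_ge z i with z₁ | z₁
  · rw [derivCirc_lt _ _ _ _ _ _ (by omega), derivCirc_lt _ _ _ _ _ _ (by omega),
      derivCirc_lt _ _ _ _ _ _ (by omega), derivCirc_lt _ _ _ _ _ _ (by omega), smul_comm]
  rcases lt_or_ge z (i + m) with z₂ | z₂
  · rw [derivCirc_lt _ _ _ _ _ _ (by omega), derivCirc_mid _ _ _ _ _ _ (by omega) (by omega),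
      derivCirc_mid _ _ _ _ _ _ (by omega) (by omega), derivCirc_lt _ _ _ _ _ _ (by omega), hq]
    refine Subtype.ext ?_
    simp [augMul, derivCirc]
    module
  rcases lt_or_ge z p with z₃ | z₃
  · rw [derivCirc_lt _ _ _ _ _ _ (by omega),
      derivCirc_ge _ _ _ _ _ _ (by omega) (by omega),
      derivCirc_ge _ _ _ _ _ _ (by omega) (by omega),
      derivCirc_lt _ _ _ _ _ _ (by omega), smul_comm]
  rcases lt_or_ge z (p + n) with z₄ | z₄
  · rw [derivCirc_mid _ _ _ _ _ _ (by omega) (by omega),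
      derivCirc_ge _ _ _ _ _ _ (by omega) (by omega),
      derivCirc_ge _ _ _ _ _ _ (by omega) (by omega),
      derivCirc_mid _ _ _ _ _ _ (by omega) (by omega),
      show (p : ℕ) + 1 - m = j by omega, show z + 1 - m - j = z - p by omega]
    refine Subtype.ext ?_
    simp [augMul, derivCirc]
    module
  · rw [derivCirc_ge _ _ _ _ _ _ (by omega) (by omega),
      derivCirc_ge _ _ _ _ _ _ (by omega) (by omega),
      derivCirc_ge _ _ _ _ _ _ (by omega) (by omega),
      derivCirc_ge _ _ _ _ _ _ (by omega) (by omega), smul_comm,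
      show z + 1 - n + 1 - m = z + 1 - m + 1 - n by omega]

/-- The operad `D_A` of an augmented algebra `A = k ⊕ Ā` (with augmentation `ε`):
`D_A(n) = k 1ₙ ⊕ ⨁_{i < n} Ā_(i)`, where the pair `(c, f)` stands for `c 1ₙ + ∑ᵢ (f i)_(i)`.
So for a basis `(δⱼ)` of `Ā` the basis vector `δⁿ_(i)j` is `(0, Pi.single i δⱼ)`,
`1ₙ = (1, 0)`, and `D_A(1) = A`. The partial compositions are
* `1ₘ ∘ᵢ 1ₙ = 1_{m+n-1}`,
* `1ₘ ∘ᵢ δ_(q) = δ_(i+q)`,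
* `δ_(s) ∘ᵢ 1ₙ = δ_(s)`, `∑_{q < n} δ_(i+q)`, `δ_(s+n-1)` for `s < i`, `s = i`, `s > i`,
* `δ_(s) ∘ᵢ δ'_(q) = (δ δ')_(i+q)` if `s = i`, and `0` otherwise

(with slots numbered from `0`), and `σ` acts by `1ₙ ∗ σ = 1ₙ` and
`δ_(i) ∗ σ = δ_(σ⁻¹ i)`. -/
def derivOperad : SymmOperad.{u, max u v} k where
  obj n := k × (Fin n → augIdeal ε)
  one := (1, 0)
  circ h i := LinearMap.mk₂ k (derivCirc ε h i)
    (fun x x' y => by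
      refine Prod.ext (add_mul _ _ _) (funext fun p => Subtype.ext ?_)
      simp only [derivCirc, Prod.snd_add, Pi.add_apply]
      rcases slotEquiv h i p with s | q <;> simp [augMul, add_mul] <;> module)
    (fun c x y => by
      refine Prod.ext (mul_assoc _ _ _) (funext fun p => Subtype.ext ?_)
      simp only [derivCirc, Prod.smul_snd, Pi.smul_apply]
      rcases slotEquiv h i p with s | q <;> simp [augMul] <;> module)
    (fun x y y' => by
      refine Prod.ext (mul_add _ _ _) (funext fun p => Subtype.ext ?_)
      simp only [derivCirc, Prod.snd_add, Pi.add_apply]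
      rcases slotEquiv h i p with s | q <;> simp [augMul, mul_add] <;> module)
    (fun c x y => by
      refine Prod.ext (mul_left_comm _ _ _) (funext fun p => Subtype.ext ?_)
      simp only [derivCirc, Prod.smul_snd, Pi.smul_apply]
      rcases slotEquiv h i p with s | q <;> simp [augMul] <;> module)
  circ_one {n} i a := by
    refine derivCirc_ext ε (mul_one _) fun z hz => ?_
    simp only [LinearMap.mk₂_apply]
    rcases lt_trichotomy z i with z₁ | z₁ | z₁
    · rw [derivCirc_lt _ _ _ _ _ _ z₁, one_smul]
    · subst z₁
      rw [derivCirc_mid _ _ _ _ _ _ (by omega) (by omega)]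
      refine Subtype.ext ?_
      simp [augMul, extZero]
    · rw [derivCirc_ge _ _ _ _ _ _ (by omega) (by omega), one_smul]
      rfl
  one_circ {n} a := by
    refine derivCirc_ext ε (one_mul _) fun z hz => ?_
    simp only [LinearMap.mk₂_apply]
    rw [derivCirc_mid _ _ _ _ _ _ (by simp) (by simpa using hz)]
    refine Subtype.ext ?_
    simp [augMul, extZero]
  assoc_seq h₁ h₂ h₃ h₄ i j p hp a b c := derivCirc_seq ε h₁ h₂ h₃ h₄ i j p hp a b c
  assoc_par h₁ h₂ h₃ h₄ i j p q hij hp hq a b c :=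
    derivCirc_par ε h₁ h₂ h₃ h₄ i j p q hij hp hq a b c
  act σ := LinearMap.prodMap LinearMap.id (LinearMap.funLeft k _ σ)
  act_one _ := rfl
  act_mul _ _ _ := rfl
  circ_act h i σ a b := by
    refine Prod.ext rfl (funext fun p => ?_)
    simp only [LinearMap.mk₂_apply, derivCirc, innerPerm, LinearMap.prodMap_apply,
      LinearMap.funLeft_apply, Equiv.trans_apply, Equiv.apply_symm_apply, LinearMap.id_apply]
    rcases slotEquiv h i p with s | q <;> simp
  act_circ h i σ a b := by
    refine Prod.ext rfl (funext fun p => ?_)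
    simp only [LinearMap.mk₂_apply, derivCirc, outerPerm, LinearMap.prodMap_apply,
      LinearMap.funLeft_apply, Equiv.trans_apply, Equiv.apply_symm_apply, LinearMap.id_apply]
    rcases slotEquiv h i p with s | q <;> simp

/-- The operation `1ₙ` of `D_A`. -/
def derivUnit (n : ℕ) : (derivOperad ε).obj n :=
  ((1, 0) : k × (Fin n → augIdeal ε))

end Derivations

/-! Everything rests on a descending filtration by ideals `I_1 ⊇ I_2 ⊇ ...` with `I_j(n) = 0` for `n
< j` and `I_i ∘ I_j ⊆ I_{i+j-1}`. The chain condition, on either side, forces `I_N = 0` for some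
`N`. If `j ≥ 2` then `2j - 1 ≥ j + 1`, so `I_{j+1} = 0` makes `I_j` square-zero, hence zero by
semiprimeness; descending, `I_2 = 0`.

In the reduced case `I_j` consists of all operations of arity at least `j`, so `I_2 = 0` leaves only
arity one. There the ideals of `P(1)` are ideals of `P`, and the classical theorem applies.

In the unitary case inserting `e₀` lowers arity, and `I_j` is `lowVanish e₀ j`. Now `I_2 = 0`
(`lowVanish_two_eq_bot`) says that an operation is determined by its restrictions to arities zero
and one. These data, with the scalar part subtracted from the unary restrictions, form a map
`profile` to `D_A`, `A = P(1)`. It is a morphism for every unitary operad (`profile_circ`), and `I_2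
= 0` makes it injective (`profile_injective`). The rest is computation in `D_A`. One-sided ideals of
`A` inside the augmentation ideal `Ā` induce one-sided ideals of `P` (`resFamily`). So `A` inherits
semiprimeness, and the chain condition inside the hyperplane `Ā`; hence it is semisimple. If `P` is
bounded above with top arity `n ≥ 2`, all compositions of two `n`-ary operations vanish, so the
unary restrictions of `P(n)` span a square-zero ideal of `A`, which is zero. If there is a 2-unit,
its iterates have profile `1ₙ`, inserting elements of `Ā` gives the remaining generators of
`D_A(n)`, and `profile` is an isomorphism. Then `dim P(n) = 1 + n dim Ā`, which yields the growth
statement. -/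

/-! ### Semiprime artinian algebras -/

section SemiprimeAlgebra

variable {k : Type u} [Field k] {R : Type v} [Ring R] [Algebra k R]

/-- `R` satisfies the descending chain condition on the left ideals contained in `K`. -/
def LeftDCC (K : Submodule k R) : Prop :=
  ∀ f : ℕ → Submodule k R, (∀ t, f t ≤ K) → (∀ t a, ∀ x ∈ f t, a * x ∈ f t) → Antitone f →
    ∃ N, ∀ t ≥ N, f t = f N

/-- `R` satisfies the descending chain condition on the right ideals contained in `K`. -/
def RightDCC (K : Submodule k R) : Prop :=
  ∀ f : ℕ → Submodule k R, (∀ t, f t ≤ K) → (∀ t a, ∀ x ∈ f t, x * a ∈ f t) → Antitone f →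
    ∃ N, ∀ t ≥ N, f t = f N

/-- `R` has no nonzero two-sided ideal of square zero. -/
def NoSquareZeroIdeal (k : Type u) [Field k] (R : Type v) [Ring R] [Algebra k R] : Prop :=
  ∀ W : Submodule k R, (∀ a, ∀ x ∈ W, a * x ∈ W) → (∀ a, ∀ x ∈ W, x * a ∈ W) →
    (∀ x ∈ W, ∀ y ∈ W, x * y = 0) → W = ⊥

/-- The augmentation ideal has codimension one. A chain either enters it, or each term is its
intersection with `Ā` plus one line on which `ε` is nonzero. -/
lemma LeftDCC.top_of_augmented (ε : R →ₐ[k] k) (h : LeftDCC (augIdeal ε)) :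
    LeftDCC (⊤ : Submodule k R) := by
  intro f _ hl hf
  by_cases hT : ∃ T, f T ≤ augIdeal ε
  · obtain ⟨T, hT⟩ := hT
    obtain ⟨N, hN⟩ := h (fun t => f (T + t)) (fun t => (hf (Nat.le_add_right T t)).trans hT)
      (fun t => hl _) (fun a b hab => hf (by omega))
    refine ⟨T + N, fun t ht => ?_⟩
    have := hN (t - T) (by omega)
    simpa [show T + (t - T) = t by omega] using this
  · push Not at hT
    obtain ⟨N, hN⟩ := h (fun t => f t ⊓ augIdeal ε) (fun t => inf_le_right)
      (fun t a x hx => ⟨hl t a x hx.1, by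
        have := hx.2
        simp only [LinearMap.mem_ker, AlgHom.toLinearMap_apply, SetLike.mem_coe, map_mul] at this ⊢
        rw [this, mul_zero]⟩) (fun a b hab => inf_le_inf_right _ (hf hab))
    refine ⟨N, fun t ht => le_antisymm (hf ht) fun y hy => ?_⟩
    obtain ⟨e, he, he'⟩ := SetLike.not_le_iff_exists.mp (hT t)
    have he₀ : ε e ≠ 0 := by simpa using he'
    -- Correcting `y` by a multiple of `e ∈ f t` moves it into the part that has already stabilised.
    have hy' : y - (ε y * (ε e)⁻¹) • e ∈ f N ⊓ augIdeal ε := by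
      refine ⟨sub_mem hy (Submodule.smul_mem _ _ (hf ht he)), ?_⟩
      simp [mul_assoc, inv_mul_cancel₀ he₀]
    rw [← hN t ht] at hy'
    simpa using add_mem hy'.1 (Submodule.smul_mem _ (ε y * (ε e)⁻¹) he)

lemma LeftDCC.isArtinianRing (h : LeftDCC (⊤ : Submodule k R)) : IsArtinianRing R := by
  refine monotone_stabilizes_iff_artinian.mp fun f => ?_
  obtain ⟨N, hN⟩ := h (fun t => (OrderDual.ofDual (f t)).restrictScalars k) (fun t => le_top)
    (fun t a x hx => Submodule.smul_mem (OrderDual.ofDual (f t)) a hx)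
    (fun a b hab => f.monotone hab)
  exact ⟨N, fun t ht => OrderDual.ofDual.injective
    (Submodule.restrictScalars_injective k R R (hN t ht).symm)⟩

/-- The Jacobson radical of an artinian ring is nilpotent; its last nonzero power, if the exponent
is positive, is a two-sided ideal of square zero. -/
lemma NoSquareZeroIdeal.isSemisimpleRing [IsArtinianRing R] (h : NoSquareZeroIdeal k R) :
    IsSemisimpleRing R := by
  classical
  rw [IsArtinianRing.isSemisimpleRing_iff_jacobson]
  have hnil : ∃ n, Ring.jacobson R ^ n = ⊥ := by
    have := IsArtinianRing.isNilpotent_jacobson_bot (R := R)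
    rwa [Ideal.jacobson_bot] at this
  by_contra hJ
  have hn := Nat.find_spec hnil
  rcases hm : Nat.find hnil with _ | _ | n
  · rw [hm, Submodule.pow_zero, Ideal.one_eq_top] at hn
    exact hJ (le_bot_iff.mp (hn ▸ le_top))
  · rw [hm, zero_add, Submodule.pow_one] at hn
    exact hJ hn
  · rw [hm] at hn
    refine Nat.find_min hnil (m := n + 1) (by omega) ?_
    have := h ((Ring.jacobson R ^ (n + 1)).restrictScalars k)
      (fun a x hx => Ideal.mul_mem_left _ a hx) (fun a x hx => Ideal.mul_mem_right a _ hx)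
      (fun x hx y hy => by
        have hxy : x * y ∈ Ring.jacobson R ^ (n + 1) * Ring.jacobson R ^ (n + 1) :=
          Ideal.mul_mem_mul hx hy
        rw [← Ideal.IsTwoSided.pow_add] at hxy
        -- Here `n + 2` is the nilpotency index, and `2(n + 1) ≥ n + 2`.
        have hle : Ring.jacobson R ^ (n + 1 + (n + 1)) ≤ Ring.jacobson R ^ (n + 1 + 1) :=
          Ideal.pow_le_pow_right (by omega)
        have := hle hxy
        rwa [hn] at this)
    exact Submodule.restrictScalars_injective k R R this

lemma RightDCC.op {K : Submodule k R} (h : RightDCC K) :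
    LeftDCC (K.comap (MulOpposite.opLinearEquiv k).symm.toLinearMap : Submodule k Rᵐᵒᵖ) := by
  intro f hK hl hf
  obtain ⟨N, hN⟩ := h (fun t => (f t).comap (MulOpposite.opLinearEquiv k).toLinearMap)
    (fun t x hx => hK t hx) (fun t a x hx => hl t (MulOpposite.op a) _ hx)
    (fun a b hab => Submodule.comap_mono (hf hab))
  exact ⟨N, fun t ht => Submodule.comap_injective_of_surjective
    (MulOpposite.opLinearEquiv k).surjective (hN t ht)⟩

lemma NoSquareZeroIdeal.op (h : NoSquareZeroIdeal k R) : NoSquareZeroIdeal k Rᵐᵒᵖ := by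
  intro W hl hr hsq
  have := h (W.comap (MulOpposite.opLinearEquiv k).toLinearMap)
    (fun a x hx => hr (MulOpposite.op a) _ hx) (fun a x hx => hl (MulOpposite.op a) _ hx)
    (fun x hx y hy => MulOpposite.op_injective (hsq _ hy _ hx))
  refine Submodule.comap_injective_of_surjective (MulOpposite.opLinearEquiv k).surjective ?_
  rw [this]
  ext
  simp

lemma NoSquareZeroIdeal.isSemisimpleRing_of_dcc (h : NoSquareZeroIdeal k R)
    (hd : LeftDCC (⊤ : Submodule k R) ∨ RightDCC (⊤ : Submodule k R)) : IsSemisimpleRing R := by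
  rcases hd with hd | hd
  · have := hd.isArtinianRing
    exact h.isSemisimpleRing
  · have := (show LeftDCC (⊤ : Submodule k Rᵐᵒᵖ) from hd.op).isArtinianRing
    exact isSemisimpleRing_mulOpposite_iff.mp h.op.isSemisimpleRing

lemma NoSquareZeroIdeal.isSemisimpleRing_of_augmented (h : NoSquareZeroIdeal k R) (ε : R →ₐ[k] k)
    (hd : LeftDCC (augIdeal ε) ∨ RightDCC (augIdeal ε)) : IsSemisimpleRing R := by
  rcases hd with hd | hd
  · have := hd.top_of_augmented.isArtinianRing
    exact h.isSemisimpleRing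
  · let ε' : Rᵐᵒᵖ →ₐ[k] k := ε.fromOpposite fun _ _ => mul_comm _ _
    have hd' : LeftDCC (augIdeal ε') := hd.op
    have := hd'.top_of_augmented.isArtinianRing
    exact isSemisimpleRing_mulOpposite_iff.mp h.op.isSemisimpleRing

end SemiprimeAlgebra

namespace PlainOperad

variable {k : Type u} [Field k] (P : PlainOperad.{u, v} k)

/-! ### Plain and symmetric operads at once

A symmetric operad is treated as a plain operad with a class `S` of admissible families. -/

/-- There is no nonzero admissible ideal of square zero. -/
def IsSemiprimeFor (S : P.Sub → Prop) : Prop :=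
  ∀ N : P.Sub, S N → P.IsLeftIdeal N → P.IsRightIdeal N →
    (∀ {m n r : ℕ} (h : m + n = r + 1) (i : Fin m), ∀ a ∈ N m, ∀ b ∈ N n, P.circ h i a b = 0) →
    N = ⊥

/-- Descending chains of admissible left ideals are eventually constant. -/
def IsLeftArtinianFor (S : P.Sub → Prop) : Prop :=
  ∀ f : ℕ → P.Sub, (∀ t, S (f t)) → (∀ t, P.IsLeftIdeal (f t)) → Antitone f →
    ∃ N, ∀ t ≥ N, f t = f N

/-- Descending chains of admissible right ideals are eventually constant. -/
def IsRightArtinianFor (S : P.Sub → Prop) : Prop :=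
  ∀ f : ℕ → P.Sub, (∀ t, S (f t)) → (∀ t, P.IsRightIdeal (f t)) → Antitone f →
    ∃ N, ∀ t ≥ N, f t = f N

variable {P}

lemma IsSemiprime.isSemiprimeFor (hP : P.IsSemiprime) (S : P.Sub → Prop) : P.IsSemiprimeFor S := by
  intro N _ hl hr hsq
  by_contra hN
  refine hP N ⟨hl, hr⟩ hN (funext fun r => ?_)
  refine (Submodule.span_eq_bot).mpr ?_
  rintro x ⟨m, n, h, i, a, b, ha, hb, rfl⟩
  exact hsq h i a ha b hb

lemma IsLeftArtinian.isLeftArtinianFor (hP : P.IsLeftArtinian) (S : P.Sub → Prop) :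
    P.IsLeftArtinianFor S :=
  fun f _ hf => hP f hf

lemma IsRightArtinian.isRightArtinianFor (hP : P.IsRightArtinian) (S : P.Sub → Prop) :
    P.IsRightArtinianFor S :=
  fun f _ hf => hP f hf

end PlainOperad

namespace SymmOperad

variable {k : Type u} [Field k] {P : SymmOperad.{u, v} k}

lemma IsSemiprime.isSemiprimeFor (hP : P.IsSemiprime) :
    P.toPlainOperad.IsSemiprimeFor P.IsSubmodule := by
  intro N hS hl hr hsq
  by_contra hN
  refine hP N ⟨⟨hS, hl⟩, hS, hr⟩ hN (funext fun r => ?_)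
  refine (Submodule.span_eq_bot).mpr ?_
  rintro x ⟨m, n, h, i, a, b, σ, ha, hb, rfl⟩
  rw [hsq h i a ha b hb, map_zero]

lemma IsLeftArtinian.isLeftArtinianFor (hP : P.IsLeftArtinian) :
    P.toPlainOperad.IsLeftArtinianFor P.IsSubmodule :=
  fun f hS hf => hP f fun t => ⟨hS t, hf t⟩

lemma IsRightArtinian.isRightArtinianFor (hP : P.IsRightArtinian) :
    P.toPlainOperad.IsRightArtinianFor P.IsSubmodule :=
  fun f hS hf => hP f fun t => ⟨hS t, hf t⟩

end SymmOperad

namespace PlainOperad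

variable {k : Type u} [Field k] (P : PlainOperad.{u, v} k)

/-! ### Reduced operads -/

open Classical in
/-- The family which agrees with `I` in the arities satisfying `p`, and is zero elsewhere. -/
noncomputable def arityPart (p : ℕ → Prop) (I : P.Sub) : P.Sub := fun n => if p n then I n else ⊥

variable {P}

lemma mem_arityPart {p : ℕ → Prop} {I : P.Sub} {n : ℕ} {x : P.obj n} :
    x ∈ P.arityPart p I n ↔ x = 0 ∨ (p n ∧ x ∈ I n) := by
  unfold arityPart
  split_ifs with h
  · refine ⟨fun hx => Or.inr ⟨h, hx⟩, ?_⟩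
    rintro (rfl | hx)
    exacts [zero_mem _, hx.2]
  · simp [h]

lemma circ_zero_left {m n r : ℕ} (h : m + n = r + 1) (i : Fin m) (b : P.obj n) :
    P.circ h i 0 b = 0 := LinearMap.map_zero₂ _ _

lemma circ_zero_right {m n r : ℕ} (h : m + n = r + 1) (i : Fin m) (a : P.obj m) :
    P.circ h i a 0 = 0 := map_zero _

/-- The family which is `L ⊆ P(1)` in arity one, and zero in all other arities. -/
def unaryFamily (L : Submodule k P.Unary) : P.Sub
  | 1 => L
  | _ => ⊥

lemma unaryFamily_mono {L L' : Submodule k P.Unary} (h : L ≤ L') :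
    P.unaryFamily L ≤ P.unaryFamily L' := by
  rintro (_ | _ | n)
  exacts [le_rfl, h, le_rfl]

section Reduced

variable {S : P.Sub → Prop} (hsemi : P.IsSemiprimeFor S)
  (hart : P.IsLeftArtinianFor S ∨ P.IsRightArtinianFor S)

include hsemi hart in
/-- A semiprime artinian operad vanishes above arity one if it vanishes in arity zero. -/
theorem IsReduced.subsingleton_of_semiprime (h₀ : P.IsReduced)
    (hS : ∀ p, S (P.arityPart p ⊤)) (n : ℕ) (hn : n ≠ 1) : Subsingleton (P.obj n) := by
  have hcirc : ∀ {m n r : ℕ} (h : m + n = r + 1) (i : Fin m) (a : P.obj m) (b : P.obj n),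
      n = 0 → P.circ h i a b = 0 := by
    rintro m n r h i a b rfl
    rw [h₀.elim b 0, circ_zero_right]
  have hl : ∀ t, P.IsLeftIdeal (P.arityPart (t ≤ ·) ⊤) := by
    intro t m n r h i a b hb
    rw [mem_arityPart] at hb ⊢
    have := i.2
    rcases hb with rfl | hb
    · exact Or.inl (circ_zero_right h i a)
    · exact Or.inr ⟨by omega, trivial⟩
  have hr : ∀ t, P.IsRightIdeal (P.arityPart (t ≤ ·) ⊤) := by
    intro t m n r h i a b ha
    rw [mem_arityPart] at ha ⊢
    rcases ha with rfl | ha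
    · exact Or.inl (circ_zero_left h i b)
    · by_cases hn : n = 0
      · exact Or.inl (hcirc h i a b hn)
      · exact Or.inr ⟨by omega, trivial⟩
  have hanti : Antitone fun t => P.arityPart (t ≤ ·) ⊤ := by
    intro s t hst n x hx
    rw [mem_arityPart] at hx ⊢
    exact hx.imp_right fun hx => ⟨hst.trans hx.1, hx.2⟩
  have hstab : ∃ N, ∀ t ≥ N, P.arityPart (t ≤ ·) ⊤ = P.arityPart (N ≤ ·) ⊤ := by
    rcases hart with hart | hart
    · exact hart _ (fun t => hS _) hl hanti
    · exact hart _ (fun t => hS _) hr hanti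
  obtain ⟨N, hN⟩ := hstab
  have hbot : P.arityPart (N ≤ ·) ⊤ = ⊥ := by
    refine funext fun n => eq_bot_iff.mpr fun x hx => ?_
    -- The stable term equals a term whose threshold exceeds the given arity `n`.
    rw [← hN (max N (n + 1)) (le_max_left _ _), mem_arityPart] at hx
    rcases hx with rfl | hx
    · exact zero_mem _
    · have := le_of_max_le_right hx.1
      omega
  have hdesc : ∀ j, P.arityPart (j + 2 ≤ ·) ⊤ = ⊥ → P.arityPart (2 ≤ ·) ⊤ = ⊥ := by
    intro j
    induction j with
    | zero => exact id
    | succ j ih =>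
      -- Two operations of arity at least `j + 2` compose to arity at least `2j + 3 ≥ j + 3`, where
      -- everything is zero.
      refine fun hj => ih (hsemi _ (hS _) (hl _) (hr _) fun {m n r} h i a ha b hb => ?_)
      rw [mem_arityPart] at ha hb
      rcases ha with rfl | ha
      · exact circ_zero_left h i b
      rcases hb with rfl | hb
      · exact circ_zero_right h i a
      have : P.circ h i a b ∈ P.arityPart (j + 1 + 2 ≤ ·) ⊤ r :=
        mem_arityPart.mpr (Or.inr ⟨by omega, trivial⟩)
      rw [hj] at this
      exact this
  have htwo : P.arityPart (2 ≤ ·) ⊤ = ⊥ :=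
    hdesc N (le_bot_iff.mp (hbot ▸ hanti (Nat.le_add_right N 2)))
  rcases n with _ | _ | n
  · exact h₀
  · exact absurd rfl hn
  · refine subsingleton_of_forall_eq 0 fun x => ?_
    have : x ∈ P.arityPart (2 ≤ ·) ⊤ (n + 2) := mem_arityPart.mpr (Or.inr ⟨by omega, trivial⟩)
    rw [htwo] at this
    exact this

lemma unaryFamily_isLeftIdeal (h₁ : ∀ n, n ≠ 1 → Subsingleton (P.obj n))
    {L : Submodule k P.Unary} (hL : ∀ a, ∀ x ∈ L, a * x ∈ L) : P.IsLeftIdeal (P.unaryFamily L) := by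
  intro m n r h i a b hb
  by_cases hm : m = 1
  · by_cases hn : n = 1
    · subst hm hn
      obtain rfl : r = 1 := by omega
      rw [Subsingleton.elim i 0]
      exact hL a b hb
    · have := h₁ n hn
      rw [Subsingleton.elim b 0, circ_zero_right]
      exact zero_mem _
  · have := h₁ m hm
    rw [Subsingleton.elim a 0, circ_zero_left]
    exact zero_mem _

lemma unaryFamily_isRightIdeal (h₁ : ∀ n, n ≠ 1 → Subsingleton (P.obj n))
    {L : Submodule k P.Unary} (hL : ∀ a, ∀ x ∈ L, x * a ∈ L) :
    P.IsRightIdeal (P.unaryFamily L) := by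
  intro m n r h i a b ha
  by_cases hm : m = 1
  · by_cases hn : n = 1
    · subst hm hn
      obtain rfl : r = 1 := by omega
      rw [Subsingleton.elim i 0]
      exact hL b a ha
    · have := h₁ n hn
      rw [Subsingleton.elim b 0, circ_zero_right]
      exact zero_mem _
  · have := h₁ m hm
    rw [Subsingleton.elim a 0, circ_zero_left]
    exact zero_mem _

include hsemi hart in
/-- The algebra `P(1)` is semisimple if `P` is semiprime artinian and concentrated in arity one. -/
theorem isSemisimpleRing_unary_of_concentrated (h₁ : ∀ n, n ≠ 1 → Subsingleton (P.obj n))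
    (hS : ∀ L, S (P.unaryFamily L)) : IsSemisimpleRing P.Unary := by
  refine NoSquareZeroIdeal.isSemisimpleRing_of_dcc (k := k) ?_ ?_
  · intro W hl hr hsq
    have : P.unaryFamily W = ⊥ := by
      refine hsemi _ (hS W) (unaryFamily_isLeftIdeal h₁ hl) (unaryFamily_isRightIdeal h₁ hr) ?_
      intro m n r h i a ha b hb
      by_cases hm : m = 1
      · by_cases hn : n = 1
        · subst hm hn
          obtain rfl : r = 1 := by omega
          rw [Subsingleton.elim i 0]
          exact hsq a ha b hb
        · have := h₁ n hn
          rw [Subsingleton.elim b 0, circ_zero_right]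
      · have := h₁ m hm
        rw [Subsingleton.elim a 0, circ_zero_left]
    exact congrFun this 1
  · refine hart.imp (fun hart f _ hf hanti => ?_) (fun hart f _ hf hanti => ?_)
    · obtain ⟨N, hN⟩ := hart (fun t => P.unaryFamily (f t)) (fun t => hS _)
        (fun t => unaryFamily_isLeftIdeal h₁ (hf t)) (fun _ _ h => unaryFamily_mono (hanti h))
      exact ⟨N, fun t ht => congrFun (hN t ht) 1⟩
    · obtain ⟨N, hN⟩ := hart (fun t => P.unaryFamily (f t)) (fun t => hS _)
        (fun t => unaryFamily_isRightIdeal h₁ (hf t)) (fun _ _ h => unaryFamily_mono (hanti h))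
      exact ⟨N, fun t ht => congrFun (hN t ht) 1⟩

end Reduced

end PlainOperad

namespace PlainOperad

variable {k : Type u} [Field k] {P : PlainOperad.{u, v} k}

/-! ### Restriction operators of unitary operads -/

section Kill

variable (e₀ : P.obj 0)

/-- The operation `a ↦ a ∘ₚ e₀`, lowering the arity by one. -/
def kill {n : ℕ} (p : Fin (n + 1)) : P.obj (n + 1) →ₗ[k] P.obj n :=
  (P.circ (m := n + 1) (n := 0) (r := n) rfl p).flip e₀

/-- Restrictions satisfy the simplicial face identities; this is parallel associativity with `e₀` in
both slots. -/
lemma kill_kill {n : ℕ} {i j : Fin (n + 1)} (hij : i ≤ j) (a : P.obj (n + 2)) :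
    kill e₀ i (kill e₀ j.succ a) = kill e₀ j (kill e₀ i.castSucc a) :=
  (P.assoc_par (l := n + 2) (m := 0) (n := 0) (r := n + 1) (s := n) (t := n + 1) rfl rfl rfl rfl i.castSucc j.succ j i
    (Fin.castSucc_lt_succ_iff.mpr hij) rfl rfl a e₀ e₀).symm

/-- This and the next two lemmas are the associativity axioms with one entry `e₀`, according to
whether the killed input lies before, inside or after the block of inputs of `b`. Hence a
restriction of a composition is again a composition, with one factor restricted. -/
lemma kill_circ_of_lt {m n r : ℕ} (h : m + 1 + n = r + 1 + 1) (h' : m + n = r + 1)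
    (i : Fin (m + 1)) (i' : Fin m) (p : Fin (r + 1)) (s : Fin (m + 1)) (hi : (i' : ℕ) + 1 = i)
    (hs : (s : ℕ) = p) (hp : (p : ℕ) < i) (a : P.obj (m + 1)) (b : P.obj n) :
    kill e₀ p (P.circ h i a b) = P.circ h' i' (kill e₀ s a) b :=
  (P.assoc_par (m := 0) (r := m) (s := r) (t := r + 1) rfl h' h rfl s i i' p (by rw [Fin.lt_def]; omega) hi hs.symm a e₀ b).symm

lemma kill_circ_of_mid {m n r : ℕ} (h : m + (n + 1) = r + 1 + 1) (h' : m + n = r + 1)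
    (i : Fin m) (p : Fin (r + 1)) (q : Fin (n + 1)) (hp : (p : ℕ) = i + q)
    (a : P.obj m) (b : P.obj (n + 1)) :
    kill e₀ p (P.circ h i a b) = P.circ h' i a (kill e₀ q b) :=
  P.assoc_seq (n := 0) (s := r) (t := n) h rfl rfl h' i q p hp a b e₀

lemma kill_circ_of_ge {m n r : ℕ} (h : m + 1 + n = r + 1 + 1) (h' : m + n = r + 1)
    (i : Fin (m + 1)) (i' : Fin m) (p : Fin (r + 1)) (s : Fin (m + 1)) (hi : (i' : ℕ) = i)
    (hs : (p : ℕ) + 1 = s + n) (his : i < s) (a : P.obj (m + 1)) (b : P.obj n) :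
    kill e₀ p (P.circ h i a b) = P.circ h' i' (kill e₀ s a) b :=
  P.assoc_par (n := 0) (s := r) (t := m) h rfl rfl h' i s p i' his hs hi a b e₀

/-- A family of subsets is stable under restrictions. -/
def KillStable (I : ∀ n, Set (P.obj n)) : Prop :=
  ∀ (n : ℕ) (p : Fin (n + 1)), ∀ a ∈ I (n + 1), kill e₀ p a ∈ I n

/-- The compositions of elements of two families. -/
def circSet (I J : ∀ n, Set (P.obj n)) (r : ℕ) : Set (P.obj r) :=
  {x | ∃ (m n : ℕ) (h : m + n = r + 1) (i : Fin m), ∃ a ∈ I m, ∃ b ∈ J n, x = P.circ h i a b}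

variable {e₀}

lemma KillStable.circSet {I J : ∀ n, Set (P.obj n)} (hI : KillStable e₀ I)
    (hJ : KillStable e₀ J) : KillStable e₀ (circSet I J) := by
  rintro r p _ ⟨m, n, h, i, a, ha, b, hb, rfl⟩
  have hi := i.2
  have hp := p.2
  rcases lt_or_ge (p : ℕ) i with h₁ | h₁
  · obtain ⟨m, rfl⟩ : ∃ m', m = m' + 1 := ⟨m - 1, by omega⟩
    exact ⟨m, n, by omega, ⟨i - 1, by omega⟩, _, hI _ ⟨p, by omega⟩ a ha, b, hb,
      kill_circ_of_lt e₀ h _ i _ p _ (by simp only; omega) rfl h₁ a b⟩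
  rcases lt_or_ge (p : ℕ) (i + n) with h₂ | h₂
  · obtain ⟨n, rfl⟩ : ∃ n', n = n' + 1 := ⟨n - 1, by omega⟩
    exact ⟨m, n, by omega, i, a, ha, _, hJ _ ⟨p - i, by omega⟩ b hb,
      kill_circ_of_mid e₀ h _ i p _ (by simp only; omega) a b⟩
  · obtain ⟨m, rfl⟩ : ∃ m', m = m' + 1 := ⟨m - 1, by omega⟩
    exact ⟨m, n, by omega, ⟨i, by omega⟩, _, hI _ ⟨p + 1 - n, by omega⟩ a ha, b, hb,
      kill_circ_of_ge e₀ h _ i _ p _ rfl (by simp only; omega)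
        (by simp only [Fin.lt_def]; omega) a b⟩

lemma killStable_univ : KillStable e₀ (fun n => (Set.univ : Set (P.obj n))) :=
  fun _ _ _ _ => trivial

end Kill

/-- Maps commuting with restrictions are multiplicative, if restrictions separate the elements of
arity at least two of the target, and the map is multiplicative in arity one. -/
theorem map_circ_of_map_kill {Q : PlainOperad.{u, w} k} {e₀ : P.obj 0} {f₀ : Q.obj 0}
    (φ : ∀ n, P.obj n →ₗ[k] Q.obj n) (he : ∀ x : P.obj 0, ∃ c : k, x = c • e₀)
    (h₀ : φ 0 e₀ = f₀)
    (hkill : ∀ {n : ℕ} (p : Fin (n + 1)) (a : P.obj (n + 1)),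
      φ n (kill e₀ p a) = kill f₀ p (φ (n + 1) a))
    (h₁ : ∀ a b : P.obj 1, φ 1 (P.circ (m := 1) (n := 1) (r := 1) rfl 0 a b)
      = Q.circ (m := 1) (n := 1) (r := 1) rfl 0 (φ 1 a) (φ 1 b))
    (hsep : ∀ {n : ℕ} (x y : Q.obj (n + 2)), (∀ p, kill f₀ p x = kill f₀ p y) → x = y)
    {m n r : ℕ} (h : m + n = r + 1) (i : Fin m) (a : P.obj m) (b : P.obj n) :
    φ r (P.circ h i a b) = Q.circ h i (φ m a) (φ n b) := by
  induction r using Nat.strong_induction_on generalizing m n with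
  | _ r ih =>
  -- A nullary `b` is a multiple of `e₀`, so composing with it is a restriction. Otherwise induct on
  -- the output arity: `r = 0` is impossible, `r = 1` is the multiplication of `P(1)`, and for `r ≥
  -- 2` both sides are compared after every restriction.
  rcases n with _ | n
  · obtain rfl : m = r + 1 := h
    obtain ⟨c, rfl⟩ := he b
    simp only [map_smul, h₀]
    exact congrArg (c • ·) (hkill i a)
  rcases r with _ | _ | r
  · have := i.2
    omega
  · have := i.2
    obtain rfl : m = 1 := by omega
    obtain rfl : n = 0 := by omega
    rw [Subsingleton.elim i 0]
    exact h₁ a b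
  refine hsep _ _ fun p => ?_
  rw [← hkill]
  have hi := i.2
  have hp := p.2
  rcases lt_or_ge (p : ℕ) i with h₁ | h₁
  · obtain ⟨m, rfl⟩ : ∃ m', m = m' + 1 := ⟨m - 1, by omega⟩
    have h' : m + (n + 1) = r + 1 + 1 := by omega
    rw [kill_circ_of_lt e₀ h h' i ⟨i - 1, by omega⟩ p ⟨p, by omega⟩ (by simp only; omega) rfl h₁,
      kill_circ_of_lt f₀ h h' i ⟨i - 1, by omega⟩ p ⟨p, by omega⟩ (by simp only; omega) rfl h₁,
      ih (r + 1) (by omega), hkill]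
  rcases lt_or_ge (p : ℕ) (i + (n + 1)) with h₂ | h₂
  · have h' : m + n = r + 1 + 1 := by omega
    rw [kill_circ_of_mid e₀ h h' i p ⟨p - i, by omega⟩ (by simp only; omega),
      kill_circ_of_mid f₀ h h' i p ⟨p - i, by omega⟩ (by simp only; omega),
      ih (r + 1) (by omega), hkill]
  · obtain ⟨m, rfl⟩ : ∃ m', m = m' + 1 := ⟨m - 1, by omega⟩
    have h' : m + (n + 1) = r + 1 + 1 := by omega
    rw [kill_circ_of_ge e₀ h h' i ⟨i, by omega⟩ p ⟨p + 1 - (n + 1), by omega⟩ rfl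
        (by simp only; omega) (by simp only [Fin.lt_def]; omega),
      kill_circ_of_ge f₀ h h' i ⟨i, by omega⟩ p ⟨p + 1 - (n + 1), by omega⟩ rfl
        (by simp only; omega) (by simp only [Fin.lt_def]; omega),
      ih (r + 1) (by omega), hkill]

/-! ### The ideals of elements all of whose restrictions to low arities vanish -/

/-- The family of elements all of whose restrictions to arities less than `j` vanish. -/
def lowVanish (e₀ : P.obj 0) (j : ℕ) : P.Sub
  | 0 => if 0 < j then ⊥ else ⊤
  | n + 1 => if n + 1 < j then ⊥ else ⨅ p, (lowVanish e₀ j n).comap (kill e₀ p)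

variable {e₀ : P.obj 0}

lemma eq_zero_of_mem_lowVanish {j n : ℕ} {a : P.obj n} (ha : a ∈ lowVanish e₀ j n) (hn : n < j) :
    a = 0 := by
  cases n <;> simpa [lowVanish, hn] using ha

lemma killStable_lowVanish (j : ℕ) : KillStable e₀ fun n => (lowVanish e₀ j n : Set (P.obj n)) := by
  intro n p a ha
  by_cases hn : n + 1 < j
  · rw [eq_zero_of_mem_lowVanish ha hn, map_zero]
    exact zero_mem _
  · simp only [lowVanish, hn, if_false, SetLike.mem_coe, Submodule.mem_iInf] at ha
    exact ha p

/-- Maximality of `lowVanish`: the ideal properties and the product estimate below only need the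
relevant compositions to be stable under restriction and zero in low arity. -/
lemma KillStable.mem_lowVanish {I : ∀ n, Set (P.obj n)} (hI : KillStable e₀ I) {j : ℕ}
    (hj : ∀ n < j, ∀ a ∈ I n, a = 0) {n : ℕ} {a : P.obj n} (ha : a ∈ I n) :
    a ∈ lowVanish e₀ j n := by
  induction n with
  | zero =>
    unfold lowVanish
    split_ifs with h
    · exact hj 0 h a ha
    · trivial
  | succ n ih =>
    unfold lowVanish
    split_ifs with h
    · exact hj _ h a ha
    · exact (Submodule.mem_iInf _).mpr fun p => ih (hI _ p a ha)

lemma lowVanish_antitone : Antitone (lowVanish e₀) := fun i _ hij n _ ha =>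
  (killStable_lowVanish _).mem_lowVanish (j := i)
    (fun _ hn _ hb => eq_zero_of_mem_lowVanish hb (hn.trans_le hij)) (n := n) ha

lemma lowVanish_isLeftIdeal {j : ℕ} (_ : 0 < j) : P.IsLeftIdeal (lowVanish e₀ j) := by
  intro m n r h i a b hb
  refine (killStable_univ.circSet (killStable_lowVanish j)).mem_lowVanish ?_
    ⟨m, n, h, i, a, trivial, b, hb, rfl⟩
  rintro r hr _ ⟨m, n, h, i, a, -, b, hb, rfl⟩
  have := i.2
  rw [eq_zero_of_mem_lowVanish hb (by omega), circ_zero_right]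

lemma lowVanish_isRightIdeal (he : ∀ x : P.obj 0, ∃ c : k, x = c • e₀) (j : ℕ) :
    P.IsRightIdeal (lowVanish e₀ j) := by
  intro m n r h i a b ha
  refine ((killStable_lowVanish j).circSet killStable_univ).mem_lowVanish ?_
    ⟨m, n, h, i, a, ha, b, trivial, rfl⟩
  rintro r hr _ ⟨m, n, h, i, a, ha, b, -, rfl⟩
  -- Composition with a nullary operation lowers the arity, so `a` itself may have arity `j`; but
  -- its restrictions of arity below `j` vanish. If `b` has inputs, then `a` already has arity below
  -- `j`.
  rcases n with _ | n
  · obtain rfl : m = r + 1 := h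
    obtain ⟨c, rfl⟩ := he b
    rw [map_smul]
    exact smul_eq_zero_of_right c (eq_zero_of_mem_lowVanish (killStable_lowVanish j _ i a ha) hr)
  · rw [eq_zero_of_mem_lowVanish ha (by omega), circ_zero_left]

/-- In output arity `r < t` one has `m + n < i + j`, so `m < i` or `n < j` and one factor is zero.
-/
lemma circ_mem_lowVanish {i j t m n r : ℕ} (ht : i + j = t + 1) (h : m + n = r + 1) (p : Fin m)
    {a : P.obj m} {b : P.obj n} (ha : a ∈ lowVanish e₀ i m) (hb : b ∈ lowVanish e₀ j n) :
    P.circ h p a b ∈ lowVanish e₀ t r := by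
  refine ((killStable_lowVanish i).circSet (killStable_lowVanish j)).mem_lowVanish ?_
    ⟨m, n, h, p, a, ha, b, hb, rfl⟩
  rintro r hr _ ⟨m, n, h, p, a, ha, b, hb, rfl⟩
  rcases lt_or_ge m i with hm | hm
  · rw [eq_zero_of_mem_lowVanish ha hm, circ_zero_left]
  · rw [eq_zero_of_mem_lowVanish hb (by omega), circ_zero_right]

/-- In a semiprime artinian unitary operad, an element is determined by its restrictions to arities
zero and one. -/
theorem lowVanish_two_eq_bot {S : P.Sub → Prop} (hsemi : P.IsSemiprimeFor S)
    (hart : P.IsLeftArtinianFor S ∨ P.IsRightArtinianFor S)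
    (he : ∀ x : P.obj 0, ∃ c : k, x = c • e₀) (hS : ∀ j, S (lowVanish e₀ j)) :
    lowVanish e₀ 2 = ⊥ := by
  have hstab : ∃ N, ∀ t ≥ N, lowVanish e₀ (t + 1) = lowVanish e₀ (N + 1) := by
    have hanti : Antitone fun t => lowVanish e₀ (t + 1) :=
      fun _ _ h => lowVanish_antitone (Nat.succ_le_succ h)
    rcases hart with hart | hart
    · exact hart _ (fun t => hS _) (fun t => lowVanish_isLeftIdeal t.succ_pos) hanti
    · exact hart _ (fun t => hS _) (fun t => lowVanish_isRightIdeal he _) hanti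
  obtain ⟨N, hN⟩ := hstab
  have hbot : lowVanish e₀ (N + 1) = ⊥ := by
    refine funext fun n => eq_bot_iff.mpr fun x hx => ?_
    rw [← hN (max N n) (le_max_left _ _)] at hx
    exact eq_zero_of_mem_lowVanish hx (Nat.lt_succ_of_le (le_max_right _ _))
  have hdesc : ∀ j, lowVanish e₀ (j + 2) = ⊥ → lowVanish e₀ 2 = ⊥ := by
    intro j
    induction j with
    | zero => exact id
    | succ j ih =>
      refine fun hj => ih (hsemi _ (hS _) (lowVanish_isLeftIdeal (by omega))
        (lowVanish_isRightIdeal he _) fun {m n r} h i a ha b hb => ?_)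
      have : P.circ h i a b ∈ lowVanish e₀ (j + 1 + 2) r :=
        -- The product of level `j + 2` with itself lies in level `2j + 3 ≥ j + 3`.
        lowVanish_antitone (by omega)
          r (circ_mem_lowVanish (t := 2 * j + 3) (by omega) h i ha hb)
      rw [hj] at this
      exact this
  exact hdesc N (le_bot_iff.mp (hbot ▸ lowVanish_antitone (by omega)))

end PlainOperad

/-! ### Restrictions in `D_A` -/

section DerivOperad

variable {k : Type u} [Field k] {A : Type v} [Ring A] [Algebra k A] (ε : A →ₐ[k] k)

lemma slotEquiv_zero {r : ℕ} (h : r + 1 + 0 = r + 1) (p : Fin (r + 1)) (q : Fin r) :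
    slotEquiv h p q = Sum.inl ⟨p.succAbove q, Fin.succAbove_ne p q⟩ := by
  rcases lt_or_ge (q : ℕ) p with hq | hq
  · have : p.succAbove q = q.castSucc := Fin.succAbove_of_castSucc_lt _ _ hq
    simp [slotEquiv, hq, this, Fin.ext_iff]
  · have : p.succAbove q = q.succ := Fin.succAbove_of_le_castSucc _ _ hq
    simp [slotEquiv, not_lt.mpr hq, this, Fin.ext_iff]

lemma derivOperad_kill {n : ℕ} (p : Fin (n + 1)) (x : k × (Fin (n + 1) → augIdeal ε)) :
    PlainOperad.kill (P := (derivOperad ε).toPlainOperad) (derivUnit ε 0) p x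
      = ((x.1, fun q => x.2 (p.succAbove q)) : k × (Fin n → augIdeal ε)) := by
  change derivCirc ε _ p x (1, 0) = _
  refine Prod.ext (mul_one _) (funext fun q => ?_)
  simp only [derivCirc, slotEquiv_zero, Sum.elim_inl, one_smul]

/-- Killing input `j` only forgets the `j`-th coordinate. With at least two inputs, each coordinate
survives some restriction. -/
lemma derivOperad_kill_separates {n : ℕ} (x y : (derivOperad ε).obj (n + 2))
    (h : ∀ p, PlainOperad.kill (P := (derivOperad ε).toPlainOperad) (derivUnit ε 0) p x
      = PlainOperad.kill (P := (derivOperad ε).toPlainOperad) (derivUnit ε 0) p y) : x = y := by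
  have h' := fun p => (derivOperad_kill ε p x).symm.trans ((h p).trans (derivOperad_kill ε p y))
  have h₀ : x.1 = y.1 := (Prod.mk.inj (h' 0)).1
  refine Prod.ext h₀ (funext fun i => ?_)
  obtain ⟨j, hj⟩ := exists_ne i
  obtain ⟨q, rfl⟩ := Fin.exists_succAbove_eq hj.symm
  exact congrFun (Prod.mk.inj (h' j)).2 q

end DerivOperad

namespace PlainOperad

variable {k : Type u} [Field k] {P : PlainOperad.{u, v} k} {e₀ : P.obj 0}

/-! ### The profile of an operation: its restrictions to arities zero and one -/

/-- The coordinate on `P(0)`. -/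
noncomputable def IsZeroUnit.coord (h : P.IsZeroUnit e₀) : P.obj 0 ≃ₗ[k] k :=
  (LinearEquiv.ofBijective (LinearMap.toSpanSingleton k (P.obj 0) e₀)
    ⟨smul_left_injective k h.1, fun x => (h.2 x).imp fun _ hc => hc.symm⟩).symm

lemma IsZeroUnit.coord_smul (h : P.IsZeroUnit e₀) (c : k) : h.coord (c • e₀) = c :=
  LinearEquiv.symm_apply_apply _ c

lemma IsZeroUnit.coord_self (h : P.IsZeroUnit e₀) : h.coord e₀ = 1 := by
  simpa using h.coord_smul 1

lemma IsZeroUnit.coord_smul_self (h : P.IsZeroUnit e₀) (x : P.obj 0) : h.coord x • e₀ = x := by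
  obtain ⟨c, rfl⟩ := h.2 x
  rw [h.coord_smul]

/-- The restriction to arity zero. -/
noncomputable def IsZeroUnit.aug (h : P.IsZeroUnit e₀) : ∀ n, P.obj n →ₗ[k] k
  | 0 => h.coord
  | n + 1 => IsZeroUnit.aug h n ∘ₗ kill e₀ 0

/-- By the face identities, the order in which the inputs are killed does not matter. -/
lemma IsZeroUnit.aug_kill (h : P.IsZeroUnit e₀) {n : ℕ} (p : Fin (n + 1)) (a : P.obj (n + 1)) :
    h.aug n (kill e₀ p a) = h.aug (n + 1) a := by
  induction n with
  | zero =>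
    rw [Fin.fin_one_eq_zero p]
    rfl
  | succ n ih =>
    cases p using Fin.cases with
    | zero => rfl
    | succ q =>
      change h.aug n (kill e₀ 0 (kill e₀ q.succ a)) = h.aug (n + 1) (kill e₀ 0 a)
      rw [kill_kill e₀ (Fin.zero_le q), ih]
      rfl

/-- The restrictions to arity one. -/
def res (e₀ : P.obj 0) : ∀ n, Fin n → P.obj n →ₗ[k] P.obj 1
  | 0, _ => 0
  | 1, _ => LinearMap.id
  | n + 2, i => Fin.cases (res e₀ (n + 1) 0 ∘ₗ kill e₀ 1)
      (fun j => res e₀ (n + 1) j ∘ₗ kill e₀ 0) i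

/-- Input `i` of the restricted operation is input `p.succAbove i` of `a`. The face identities
reorder the restrictions so that the recursion for `res` applies. -/
lemma res_kill {n : ℕ} (p : Fin (n + 1)) (i : Fin n) (a : P.obj (n + 1)) :
    res e₀ n i (kill e₀ p a) = res e₀ (n + 1) (p.succAbove i) a := by
  induction n with
  | zero => exact i.elim0
  | succ n ih =>
    cases p using Fin.cases with
    | zero =>
      rw [Fin.succAbove_zero]
      rfl
    | succ q =>
      rcases n with _ | n
      · obtain rfl : q = 0 := Fin.fin_one_eq_zero _
        obtain rfl : i = 0 := Fin.fin_one_eq_zero _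
        rfl
      cases i using Fin.cases with
      | zero =>
        rw [Fin.succ_succAbove_zero]
        cases q using Fin.cases with
        | zero => rfl
        | succ q =>
          change res e₀ (n + 1) 0 (kill e₀ 1 (kill e₀ q.succ.succ a))
            = res e₀ (n + 2) 0 (kill e₀ 1 a)
          rw [kill_kill e₀ (show (1 : Fin (n + 1 + 1)) ≤ q.succ by simp [Fin.le_def]), ih,
            Fin.succ_succAbove_zero]
          rfl
      | succ j =>
        rw [Fin.succ_succAbove_succ]
        change res e₀ (n + 1) j (kill e₀ 0 (kill e₀ q.succ a))
            = res e₀ (n + 2) (q.succAbove j) (kill e₀ 0 a)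
        rw [kill_kill e₀ (Fin.zero_le q), ih]
        rfl

lemma IsZeroUnit.aug_res (h : P.IsZeroUnit e₀) {n : ℕ} (i : Fin n) (a : P.obj n) :
    h.aug 1 (res e₀ n i a) = h.aug n a := by
  induction n with
  | zero => exact i.elim0
  | succ n ih =>
    rcases n with _ | n
    · rfl
    · obtain ⟨j, hj⟩ := exists_ne i
      obtain ⟨q, rfl⟩ := Fin.exists_succAbove_eq hj.symm
      rw [← res_kill, ih, h.aug_kill]

lemma IsZeroUnit.aug_smul (h : P.IsZeroUnit e₀) (a : P.obj 1) :
    P.circ (m := 1) (n := 0) (r := 0) rfl 0 a e₀ = h.aug 1 a • e₀ :=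
  (h.coord_smul_self _).symm

lemma IsZeroUnit.aug_mul (h : P.IsZeroUnit e₀) (a b : P.obj 1) :
    h.aug 1 (P.circ (m := 1) (n := 1) (r := 1) rfl 0 a b) = h.aug 1 a * h.aug 1 b := by
  change h.coord (P.circ (m := 1) (n := 0) (r := 0) rfl 0 (P.circ (m := 1) (n := 1) (r := 1)
    rfl 0 a b) e₀) = _
  rw [P.assoc_seq (l := 1) (m := 1) (n := 0) (t := 0) rfl rfl rfl rfl 0 0 0 rfl a b e₀,
    h.aug_smul b, map_smul, h.aug_smul a, smul_smul, h.coord_smul, mul_comm]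

/-- The augmentation of `P(1)` given by a `0`-unit. -/
noncomputable def IsZeroUnit.augmentation (h : P.IsZeroUnit e₀) : P.Unary →ₐ[k] k :=
  AlgHom.ofLinearMap (h.aug 1 : P.obj 1 →ₗ[k] k)
    (by
      change h.coord (P.circ (m := 1) (n := 0) (r := 0) rfl 0 P.one e₀) = 1
      rw [P.one_circ (n := 0), h.coord_self])
    h.aug_mul

lemma IsZeroUnit.isAugmentation (h : P.IsZeroUnit e₀) : P.IsAugmentation e₀ h.augmentation :=
  fun a => h.aug_smul a

lemma IsZeroUnit.aug_one (h : P.IsZeroUnit e₀) : h.aug 1 P.one = 1 := map_one h.augmentation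

/-- The arity one restrictions, corrected so as to lie in the augmentation ideal. -/
noncomputable def IsZeroUnit.resBar (h : P.IsZeroUnit e₀) (n : ℕ) (i : Fin n) :
    P.obj n →ₗ[k] augIdeal h.augmentation :=
  LinearMap.codRestrict (augIdeal h.augmentation)
    (res e₀ n i - (LinearMap.toSpanSingleton k (P.obj 1) P.one) ∘ₗ h.aug n : P.obj n →ₗ[k] P.obj 1)
    (fun a => by
      change h.aug 1 (res e₀ n i a - h.aug n a • P.one) = 0
      rw [map_sub, map_smul, h.aug_res, h.aug_one, smul_eq_mul, mul_one, sub_self])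

lemma IsZeroUnit.coe_resBar (h : P.IsZeroUnit e₀) {n : ℕ} (i : Fin n) (a : P.obj n) :
    (h.resBar n i a : P.Unary) = (res e₀ n i a - h.aug n a • P.one : P.obj 1) := rfl

/-- The comparison map `P → D_A`, `A = P(1)`. -/
noncomputable def IsZeroUnit.profile (h : P.IsZeroUnit e₀) (n : ℕ) :
    P.obj n →ₗ[k] (derivOperad h.augmentation).obj n :=
  (LinearMap.prod (h.aug n) (LinearMap.pi (h.resBar n)) :
    P.obj n →ₗ[k] k × (Fin n → augIdeal h.augmentation))

lemma IsZeroUnit.profile_zeroUnit (h : P.IsZeroUnit e₀) :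
    h.profile 0 e₀ = derivUnit h.augmentation 0 :=
  Prod.ext h.coord_self (Subsingleton.elim _ _)

lemma IsZeroUnit.profile_one (h : P.IsZeroUnit e₀) :
    h.profile 1 P.one = derivUnit h.augmentation 1 := by
  refine Prod.ext h.aug_one (funext fun i => Subtype.ext ?_)
  change P.one - h.aug 1 P.one • P.one = 0
  rw [h.aug_one, one_smul, sub_self]

lemma IsZeroUnit.profile_kill (h : P.IsZeroUnit e₀) {n : ℕ} (p : Fin (n + 1))
    (a : P.obj (n + 1)) :
    h.profile n (kill e₀ p a)
      = kill (P := (derivOperad h.augmentation).toPlainOperad) (derivUnit h.augmentation 0) p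
        (h.profile (n + 1) a) := by
  refine Eq.trans ?_ (derivOperad_kill _ p _).symm
  refine Prod.ext (h.aug_kill p a) (funext fun i => Subtype.ext ?_)
  change res e₀ n i (kill e₀ p a) - h.aug n (kill e₀ p a) • P.one
    = res e₀ (n + 1) (p.succAbove i) a - h.aug (n + 1) a • P.one
  rw [res_kill, h.aug_kill]

lemma IsZeroUnit.profile_mul (h : P.IsZeroUnit e₀) (a b : P.obj 1) :
    h.profile 1 (P.circ (m := 1) (n := 1) (r := 1) rfl 0 a b)
      = (derivOperad h.augmentation).circ (m := 1) (n := 1) (r := 1) rfl 0 (h.profile 1 a)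
        (h.profile 1 b) := by
  refine derivCirc_ext h.augmentation (h.aug_mul a b) fun p hp => ?_
  obtain rfl : p = 0 := by omega
  refine Eq.trans ?_ (derivCirc_mid h.augmentation _ _ _ _ _ (by simp) (by simp)).symm
  refine Subtype.ext ?_
  -- The multiplication of `A = k ⊕ Ā` in coordinates, which is the inner-slot formula of
  -- `derivCirc`.
  have key : ∀ (a b : P.Unary) (α β : k), a * b - (α * β) • (1 : P.Unary)
      = α • (b - β • (1 : P.Unary)) + β • (a - α • (1 : P.Unary))
        + (a - α • (1 : P.Unary)) * (b - β • (1 : P.Unary)) := by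
    intro a b α β
    simp only [sub_mul, mul_sub, smul_sub, smul_mul_assoc, mul_smul_comm, one_mul, mul_one]
    module
  have := key a b (h.aug 1 a) (h.aug 1 b)
  rw [← h.aug_mul] at this
  exact this

/-- The comparison map `P → D_A` is a morphism of operads. -/
theorem IsZeroUnit.profile_circ (h : P.IsZeroUnit e₀) {m n r : ℕ} (hr : m + n = r + 1) (i : Fin m)
    (a : P.obj m) (b : P.obj n) :
    h.profile r (P.circ hr i a b)
      = (derivOperad h.augmentation).circ hr i (h.profile m a) (h.profile n b) :=
  map_circ_of_map_kill (Q := (derivOperad h.augmentation).toPlainOperad) h.profile h.2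
    h.profile_zeroUnit h.profile_kill h.profile_mul
    (derivOperad_kill_separates h.augmentation) hr i a b

/-- The kernels are stable under restriction and vanish in arities zero and one, so they lie in
`lowVanish e₀ 2`. -/
lemma IsZeroUnit.profile_injective (h : P.IsZeroUnit e₀) (h₂ : lowVanish e₀ 2 = ⊥) (n : ℕ) :
    Function.Injective (h.profile n) := by
  rw [← LinearMap.ker_eq_bot, eq_bot_iff]
  have hI : KillStable e₀ fun n => (LinearMap.ker (h.profile n) : Set (P.obj n)) := by
    intro n p a ha
    have ha' : h.profile (n + 1) a = 0 := ha
    change h.profile n _ = 0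
    rw [h.profile_kill, ha', map_zero]
  have key : ∀ n < 2, ∀ a ∈ (LinearMap.ker (h.profile n) : Set (P.obj n)), a = 0 := by
    intro n hn a ha
    have ha' : h.profile n a = 0 := ha
    have haug : h.aug n a = 0 := congrArg Prod.fst ha'
    interval_cases n
    · exact (LinearEquiv.map_eq_zero_iff h.coord).mp haug
    · have : (h.resBar 1 0 a : P.Unary) = 0 :=
        congrArg Subtype.val (congrFun (congrArg Prod.snd ha') 0)
      rw [h.coe_resBar, haug, zero_smul, sub_zero] at this
      exact this
  intro a ha
  have := hI.mem_lowVanish key ha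
  rw [h₂] at this
  exact this

end PlainOperad

namespace PlainOperad

variable {k : Type u} [Field k] {P : PlainOperad.{u, v} k} {e₀ : P.obj 0}

/-! ### Semisimplicity of `P(1)` for unitary operads -/

lemma IsZeroUnit.aug_circ (h : P.IsZeroUnit e₀) {m n r : ℕ} (hr : m + n = r + 1) (i : Fin m)
    (a : P.obj m) (b : P.obj n) : h.aug r (P.circ hr i a b) = h.aug m a * h.aug n b :=
  (Prod.mk.inj (h.profile_circ hr i a b)).1

lemma IsZeroUnit.resBar_circ (h : P.IsZeroUnit e₀) {m n r : ℕ} (hr : m + n = r + 1) (i : Fin m)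
    (a : P.obj m) (b : P.obj n) (p : Fin r) :
    h.resBar r p (P.circ hr i a b) = Sum.elim
      (fun s : {x : Fin m // x ≠ i} => h.aug n b • h.resBar m s.1 a)
      (fun q => h.aug m a • h.resBar n q b + h.aug n b • h.resBar m i a
        + augMul h.augmentation (h.resBar m i a) (h.resBar n q b)) (slotEquiv hr i p) :=
  congrFun (Prod.mk.inj (h.profile_circ hr i a b)).2 p

lemma IsZeroUnit.resBar_circ_inner (h : P.IsZeroUnit e₀) {m n r : ℕ} (hr : m + n = r + 1)
    (i : Fin m) (a : P.obj m) (b : P.obj n) (q : Fin n) :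
    (h.resBar r ((slotEquiv hr i).symm (Sum.inr q)) (P.circ hr i a b) : P.Unary)
      = h.aug m a • (h.resBar n q b : P.Unary) + h.aug n b • (h.resBar m i a : P.Unary)
        + (h.resBar m i a : P.Unary) * h.resBar n q b := by
  rw [h.resBar_circ, Equiv.apply_symm_apply]
  rfl

lemma IsZeroUnit.resBar_unary (h : P.IsZeroUnit e₀) (i : Fin 1) (a : P.Unary) :
    (h.resBar 1 i a : P.Unary) = a - h.aug 1 a • (1 : P.Unary) := rfl

lemma IsZeroUnit.eq_zero_of_resBar (h : P.IsZeroUnit e₀) (h₂ : lowVanish e₀ 2 = ⊥) {n : ℕ}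
    {a : P.obj n} (ha : h.aug n a = 0) (ha' : ∀ i, (h.resBar n i a : P.Unary) = 0) : a = 0 :=
  h.profile_injective h₂ n ((Prod.ext ha (funext fun i => Subtype.ext (ha' i)) :
    h.profile n a = (0 : k × (Fin n → augIdeal h.augmentation))).trans
      (map_zero (h.profile n)).symm)

/-! ### Ideals of a unitary operad induced by ideals of `P(1)` -/

/-- The family of operations whose restrictions to arity one lie in `W` and whose restriction to
arity zero vanishes. -/
noncomputable def IsZeroUnit.resFamily (h : P.IsZeroUnit e₀) (W : Submodule k P.Unary) : P.Sub :=
  fun n => LinearMap.ker (h.aug n) ⊓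
    ⨅ i, W.comap ((augIdeal h.augmentation).subtype ∘ₗ h.resBar n i)

lemma IsZeroUnit.mem_resFamily (h : P.IsZeroUnit e₀) {W : Submodule k P.Unary} {n : ℕ}
    {a : P.obj n} :
    a ∈ h.resFamily W n ↔ h.aug n a = 0 ∧ ∀ i, (h.resBar n i a : P.Unary) ∈ W := by
  simp [resFamily]

/-- On `Ā` the scalar correction in `resBar` vanishes, so `W ⊆ Ā` is recovered from its family; a
chain in `Ā` therefore stabilises when the induced chain does. -/
lemma IsZeroUnit.mem_resFamily_unary (h : P.IsZeroUnit e₀) {W : Submodule k P.Unary}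
    (hW : W ≤ augIdeal h.augmentation) {a : P.Unary} : a ∈ h.resFamily W 1 ↔ a ∈ W := by
  refine (h.mem_resFamily (n := 1)).trans ?_
  constructor
  · rintro ⟨h₁, h₂⟩
    have := h₂ 0
    rwa [h.resBar_unary, h₁, zero_smul, sub_zero] at this
  · intro ha
    have h₁ : h.aug 1 a = 0 := hW ha
    refine ⟨h₁, fun i => ?_⟩
    rwa [h.resBar_unary, h₁, zero_smul, sub_zero]

lemma IsZeroUnit.resFamily_mono (h : P.IsZeroUnit e₀) : Monotone h.resFamily := by
  intro W W' hW n a ha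
  rw [h.mem_resFamily] at ha ⊢
  exact ⟨ha.1, fun i => hW (ha.2 i)⟩

/-- Since `b` has augmentation zero, the composition has zero coordinates outside the block of `b`;
inside, those of `b` are multiplied on the left by an element of `A`. -/
lemma IsZeroUnit.resFamily_isLeftIdeal (h : P.IsZeroUnit e₀) {W : Submodule k P.Unary}
    (hW : ∀ a, ∀ x ∈ W, a * x ∈ W) : P.IsLeftIdeal (h.resFamily W) := by
  intro m n r hr i a b hb
  rw [h.mem_resFamily] at hb ⊢
  refine ⟨by rw [h.aug_circ, hb.1, mul_zero], fun p => ?_⟩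
  rw [h.resBar_circ, hb.1]
  rcases slotEquiv hr i p with s | q
  · rw [Sum.elim_inl, zero_smul]
    exact zero_mem _
  · rw [Sum.elim_inr, zero_smul, add_zero]
    exact add_mem (W.smul_mem _ (hb.2 q)) (hW _ _ (hb.2 q))

lemma IsZeroUnit.resFamily_isRightIdeal (h : P.IsZeroUnit e₀) {W : Submodule k P.Unary}
    (hW : ∀ a, ∀ x ∈ W, x * a ∈ W) : P.IsRightIdeal (h.resFamily W) := by
  intro m n r hr i a b ha
  rw [h.mem_resFamily] at ha ⊢
  refine ⟨by rw [h.aug_circ, ha.1, zero_mul], fun p => ?_⟩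
  rw [h.resBar_circ, ha.1]
  rcases slotEquiv hr i p with s | q
  · exact W.smul_mem _ (ha.2 s)
  · rw [Sum.elim_inr, zero_smul, zero_add]
    exact add_mem (W.smul_mem _ (ha.2 i)) (hW _ _ (ha.2 i))

lemma IsZeroUnit.circ_eq_zero_of_mem_resFamily (h : P.IsZeroUnit e₀) (h₂ : lowVanish e₀ 2 = ⊥)
    {W : Submodule k P.Unary} (hW : ∀ x ∈ W, ∀ y ∈ W, x * y = 0) {m n r : ℕ} (hr : m + n = r + 1)
    (i : Fin m) {a : P.obj m} (ha : a ∈ h.resFamily W m) {b : P.obj n}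
    (hb : b ∈ h.resFamily W n) : P.circ hr i a b = 0 := by
  rw [h.mem_resFamily] at ha hb
  refine h.eq_zero_of_resBar h₂ (by rw [h.aug_circ, ha.1, zero_mul]) fun p => ?_
  rw [h.resBar_circ, ha.1, hb.1]
  rcases slotEquiv hr i p with s | q
  · rw [Sum.elim_inl, zero_smul]
    rfl
  · rw [Sum.elim_inr, zero_smul, zero_smul, zero_add, zero_add]
    exact hW _ (ha.2 i) _ (hb.2 q)

section Semiprime

variable {S : P.Sub → Prop} (hsemi : P.IsSemiprimeFor S) (h : P.IsZeroUnit e₀)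
  (h₂ : lowVanish e₀ 2 = ⊥)

include hsemi h₂ in
lemma IsZeroUnit.noSquareZeroIdeal_unary (hS : ∀ W, S (h.resFamily W)) :
    NoSquareZeroIdeal k P.Unary := by
  intro W hl hr hsq
  -- A square-zero ideal is killed by any character to a field.
  have hW : W ≤ augIdeal h.augmentation := by
    intro x hx
    have : h.augmentation x * h.augmentation x = 0 := by
      rw [← map_mul, hsq x hx x hx, map_zero]
    exact mul_self_eq_zero.mp this
  have hbot : h.resFamily W = ⊥ :=
    hsemi _ (hS W) (h.resFamily_isLeftIdeal hl) (h.resFamily_isRightIdeal hr)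
      fun hr i _ ha _ hb => h.circ_eq_zero_of_mem_resFamily h₂ hsq hr i ha hb
  refine eq_bot_iff.mpr fun x hx => ?_
  have := (h.mem_resFamily_unary hW).mpr hx
  rw [hbot] at this
  exact this

include hsemi h₂ in
/-- The algebra `P(1)` of a semiprime artinian unitary operad is semisimple. -/
theorem IsZeroUnit.isSemisimpleRing_unary (hart : P.IsLeftArtinianFor S ∨ P.IsRightArtinianFor S)
    (hS : ∀ W, S (h.resFamily W)) : IsSemisimpleRing P.Unary := by
  refine (h.noSquareZeroIdeal_unary hsemi h₂ hS).isSemisimpleRing_of_augmented h.augmentation ?_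
  refine hart.imp (fun hart f hK hf hanti => ?_) (fun hart f hK hf hanti => ?_)
  · obtain ⟨N, hN⟩ := hart (fun t => h.resFamily (f t)) (fun t => hS _)
      (fun t => h.resFamily_isLeftIdeal (hf t)) (fun _ _ hst => h.resFamily_mono (hanti hst))
    refine ⟨N, fun t ht => Submodule.ext fun x => ?_⟩
    rw [← h.mem_resFamily_unary (hK t), hN t ht, h.mem_resFamily_unary (hK N)]
  · obtain ⟨N, hN⟩ := hart (fun t => h.resFamily (f t)) (fun t => hS _)
      (fun t => h.resFamily_isRightIdeal (hf t)) (fun _ _ hst => h.resFamily_mono (hanti hst))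
    refine ⟨N, fun t ht => Submodule.ext fun x => ?_⟩
    rw [← h.mem_resFamily_unary (hK t), hN t ht, h.mem_resFamily_unary (hK N)]

-- In top arity `n ≥ 2` the composition of two operations has arity `2n - 1 > n` and is zero. Its
-- profile then shows that augmentations vanish and that the unary restrictions multiply to zero;
-- they span a square-zero ideal of `A`.
include hsemi h₂ in
lemma IsZeroUnit.subsingleton_of_top_arity (hS : ∀ W, S (h.resFamily W)) {n : ℕ} (hn : 2 ≤ n)
    (htop : ∀ m, n < m → Subsingleton (P.obj m)) : Subsingleton (P.obj n) := by
  have hnn : n + n = n + n - 1 + 1 := by omega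
  have hzero : ∀ (i : Fin n) (a b : P.obj n), P.circ hnn i a b = 0 := fun i a b =>
    (htop (n + n - 1) (by omega)).elim _ _
  have haug : ∀ a : P.obj n, h.aug n a = 0 := fun a => by
    have := h.aug_circ hnn ⟨0, by omega⟩ a a
    rw [hzero, map_zero] at this
    exact mul_self_eq_zero.mp this.symm
  let W : Submodule k P.Unary :=
    Submodule.span k {x | ∃ (a : P.obj n) (i : Fin n), x = h.resBar n i a}
  have hmem : ∀ (i : Fin n) (a : P.obj n), (h.resBar n i a : P.Unary) ∈ W := fun i a =>
    Submodule.subset_span ⟨a, i, rfl⟩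
  have hmul : ∀ (i j : Fin n) (a b : P.obj n),
      (h.resBar n i a : P.Unary) * h.resBar n j b = 0 := fun i j a b => by
    have := h.resBar_circ_inner hnn i a b j
    rw [hzero, haug, haug, map_zero, zero_smul, zero_smul, zero_add, zero_add] at this
    exact this.symm
  have hW : W = ⊥ := by
    refine h.noSquareZeroIdeal_unary hsemi h₂ hS W (fun c x hx => ?_) (fun c x hx => ?_)
      (fun x hx y hy => ?_)
    · induction hx using Submodule.span_induction with
      | mem x hx =>
        obtain ⟨a, i, rfl⟩ := hx
        -- As `a` has augmentation zero, this reads `resBar (c ∘ a) = c * resBar a`, so `W` absorbs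
        -- `c` on the left; the right-hand case is symmetric.
        have := h.resBar_circ_inner (Nat.add_comm 1 n) 0 c a i
        rw [haug, zero_smul, add_zero, h.resBar_unary, sub_mul, smul_mul_assoc, one_mul,
          add_sub_cancel] at this
        rw [← this]
        exact hmem _ _
      | zero => rw [mul_zero]; exact zero_mem _
      | add x y _ _ hx hy => rw [mul_add]; exact add_mem hx hy
      | smul t x _ hx => rw [mul_smul_comm]; exact W.smul_mem t hx
    · induction hx using Submodule.span_induction with
      | mem x hx =>
        obtain ⟨a, i, rfl⟩ := hx
        have := h.resBar_circ_inner (n := 1) (r := n) rfl i a c 0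
        rw [haug, zero_smul, zero_add, h.resBar_unary, mul_sub, mul_smul_comm, mul_one,
          add_sub_cancel] at this
        rw [← this]
        exact hmem _ _
      | zero => rw [zero_mul]; exact zero_mem _
      | add x y _ _ hx hy => rw [add_mul]; exact add_mem hx hy
      | smul t x _ hx => rw [smul_mul_assoc]; exact W.smul_mem t hx
    · induction hx, hy using Submodule.span_induction₂ with
      | mem_mem x y hx hy =>
        obtain ⟨a, i, rfl⟩ := hx
        obtain ⟨b, j, rfl⟩ := hy
        exact hmul i j a b
      | zero_left y _ => exact zero_mul y
      | zero_right x _ => exact mul_zero x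
      | add_left x y z _ _ _ h₁ h₂ => rw [add_mul, h₁, h₂, add_zero]
      | add_right x y z _ _ _ h₁ h₂ => rw [mul_add, h₁, h₂, add_zero]
      | smul_left t x y _ _ h₁ => rw [smul_mul_assoc, h₁, smul_zero]
      | smul_right t x y _ _ h₁ => rw [mul_smul_comm, h₁, smul_zero]
  refine subsingleton_of_forall_eq 0 fun a => h.eq_zero_of_resBar h₂ (haug a) fun i => ?_
  have := hmem i a
  rw [hW] at this
  exact this

include hsemi h₂ in
/-- A semiprime artinian unitary operad which is bounded above vanishes above arity one. -/
theorem IsZeroUnit.subsingleton_of_isBoundedAbove (hS : ∀ W, S (h.resFamily W))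
    (hb : P.IsBoundedAbove) {n : ℕ} (hn : 2 ≤ n) : Subsingleton (P.obj n) := by
  obtain ⟨N, hN⟩ := hb
  have key : ∀ d n, 2 ≤ n → N ≤ n + d → Subsingleton (P.obj n) := by
    intro d
    induction d with
    | zero => exact fun n _ h => hN n h
    | succ d ih =>
      exact fun n hn hd => h.subsingleton_of_top_arity hsemi h₂ hS hn
        fun m hm => ih m (by omega) (by omega)
  exact key N n hn (by omega)

end Semiprime

lemma IsZeroUnit.finrank_eq_one (h : P.IsZeroUnit e₀) : Module.finrank k (P.obj 0) = 1 :=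
  (LinearEquiv.finrank_eq h.coord).trans (Module.finrank_self k)

end PlainOperad

namespace SymmOperad

variable {k : Type u} [Field k] {P : SymmOperad.{u, v} k}

open PlainOperad

/-! ### Stability of the relevant families under the symmetric group actions -/

lemma isSubmodule_arityPart (p : ℕ → Prop) :
    P.IsSubmodule (P.toPlainOperad.arityPart p ⊤) := by
  intro n σ a ha
  rw [mem_arityPart] at ha ⊢
  exact ha.imp (fun ha => by rw [ha, map_zero]) id

lemma act_of_subsingleton {n : ℕ} [Subsingleton (Fin n)] (σ : Equiv.Perm (Fin n)) (a : P.obj n) :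
    P.act σ a = a := by
  rw [Subsingleton.elim σ 1, P.act_one]

lemma isSubmodule_unaryFamily (L : Submodule k P.Unary) :
    P.IsSubmodule (P.toPlainOperad.unaryFamily L) := by
  intro n σ a ha
  rcases n with _ | _ | n
  · rwa [act_of_subsingleton]
  · rwa [act_of_subsingleton (n := 1)]
  · have ha' : a = 0 := ha
    rw [ha', map_zero]
    exact zero_mem _

lemma kill_act (e₀ : P.obj 0) {n : ℕ} (p : Fin (n + 1)) (σ : Equiv.Perm (Fin (n + 1)))
    (a : P.obj (n + 1)) :
    kill e₀ p (P.act σ a)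
      = P.act (outerPerm (n := 0) (r := n) rfl p σ) (kill e₀ (σ p) a) :=
  P.act_circ (n := 0) (r := n) rfl p σ a e₀

lemma isSubmodule_lowVanish (e₀ : P.obj 0) (j : ℕ) :
    P.IsSubmodule (lowVanish (P := P.toPlainOperad) e₀ j) := by
  intro n σ a ha
  -- Restricting `a ∗ σ` at `p` is restricting `a` at `σ p` and then permuting, so the orbits of
  -- `lowVanish` form a stable family.
  have hI : KillStable (P := P.toPlainOperad) e₀ fun n =>
      {x | ∃ (σ : Equiv.Perm (Fin n)), ∃ a ∈ lowVanish e₀ j n, x = P.act σ a} := by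
    rintro n p _ ⟨σ, a, ha, rfl⟩
    exact ⟨_, _, killStable_lowVanish j n (σ p) a ha, kill_act e₀ p σ a⟩
  refine hI.mem_lowVanish ?_ ⟨σ, a, ha, rfl⟩
  rintro n hn _ ⟨σ, a, ha, rfl⟩
  rw [eq_zero_of_mem_lowVanish ha hn, map_zero]

variable {e₀ : P.obj 0}

/-- The comparison map `P → D_A` is equivariant. -/
theorem profile_act (h : P.IsZeroUnit e₀) {n : ℕ} (σ : Equiv.Perm (Fin n)) (a : P.obj n) :
    h.profile n (P.act σ a) = (derivOperad h.augmentation).act σ (h.profile n a) := by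
  induction n with
  | zero => rw [act_of_subsingleton, act_of_subsingleton]
  | succ n ih =>
    rcases n with _ | n
    · rw [act_of_subsingleton (n := 1), act_of_subsingleton (n := 1)]
    -- Restrictions separate, and both operads use the same induced permutation after restriction,
    -- so the claim descends to lower arity.
    · refine derivOperad_kill_separates _ _ _ fun p => ?_
      rw [← h.profile_kill, kill_act, ih, kill_act, h.profile_kill]

lemma aug_act (h : P.IsZeroUnit e₀) {n : ℕ} (σ : Equiv.Perm (Fin n)) (a : P.obj n) :
    h.aug n (P.act σ a) = h.aug n a :=
  (Prod.mk.inj (profile_act h σ a)).1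

lemma resBar_act (h : P.IsZeroUnit e₀) {n : ℕ} (σ : Equiv.Perm (Fin n)) (a : P.obj n)
    (i : Fin n) : h.resBar n i (P.act σ a) = h.resBar n (σ i) a :=
  congrFun (Prod.mk.inj (profile_act h σ a)).2 i

lemma isSubmodule_resFamily (h : P.IsZeroUnit e₀) (W : Submodule k P.Unary) :
    P.IsSubmodule (h.resFamily W) := by
  intro n σ a ha
  rw [h.mem_resFamily] at ha ⊢
  refine ⟨by rw [aug_act, ha.1], fun i => ?_⟩
  rw [resBar_act]
  exact ha.2 (σ i)

end SymmOperad

namespace PlainOperad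

variable {k : Type u} [Field k] {P : PlainOperad.{u, v} k} {e₀ : P.obj 0} {e₂ : P.obj 2}

/-! ### Surjectivity of the comparison map for 2-unitary operads -/

/-- The operations `1ₙ` of a 2-unitary operad. -/
def iteratedUnit (e₀ : P.obj 0) (e₂ : P.obj 2) : ∀ n, P.obj n
  | 0 => e₀
  | 1 => P.one
  | n + 2 => P.circ (m := 2) (n := n + 1) (r := n + 2) (by omega) 0 e₂ (iteratedUnit e₀ e₂ (n + 1))

lemma IsZeroUnit.aug_iteratedUnit_circ (h : P.IsZeroUnit e₀) {n : ℕ} (i : Fin n)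
    (δ : augIdeal h.augmentation) :
    h.aug n (P.circ (n := 1) (r := n) rfl i (iteratedUnit e₀ e₂ n) (δ : P.Unary)) = 0 := by
  have hδ : h.aug 1 (δ : P.Unary) = 0 := δ.2
  exact (h.aug_circ _ _ _ _).trans ((congrArg _ hδ).trans (mul_zero _))

section TwoUnit

variable (h : P.IsZeroUnit e₀) (h' : P.IsTwoUnit e₀ e₂)

include h'

lemma IsZeroUnit.aug_twoUnit : h.aug 2 e₂ = 1 := by
  change h.aug 1 (kill e₀ 0 e₂) = 1
  rw [show kill e₀ 0 e₂ = P.one from h'.2, h.aug_one]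

lemma IsZeroUnit.resBar_twoUnit (i : Fin 2) : h.resBar 2 i e₂ = 0 := by
  refine Subtype.ext ?_
  have hres : res e₀ 2 i e₂ = P.one := by
    fin_cases i
    exacts [h'.1, h'.2]
  have := h.coe_resBar i e₂
  rw [hres, h.aug_twoUnit h', one_smul, sub_self] at this
  exact this

lemma IsZeroUnit.profile_twoUnit : h.profile 2 e₂ = derivUnit h.augmentation 2 :=
  Prod.ext (h.aug_twoUnit h') (funext fun i => h.resBar_twoUnit h' i)

lemma IsZeroUnit.aug_iteratedUnit (n : ℕ) : h.aug n (iteratedUnit e₀ e₂ n) = 1 := by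
  induction n with
  | zero => exact h.coord_self
  | succ n ih =>
    rcases n with _ | n
    · exact h.aug_one
    · rw [iteratedUnit, h.aug_circ, h.aug_twoUnit h', ih, mul_one]

lemma IsZeroUnit.resBar_iteratedUnit (n : ℕ) (i : Fin n) :
    h.resBar n i (iteratedUnit e₀ e₂ n) = 0 := by
  induction n with
  | zero => exact i.elim0
  | succ n ih =>
    rcases n with _ | n
    · exact congrFun (Prod.mk.inj h.profile_one).2 i
    · rw [iteratedUnit, h.resBar_circ]
      rcases slotEquiv _ _ i with s | q
      · rw [Sum.elim_inl, h.resBar_twoUnit h', smul_zero]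
      · rw [Sum.elim_inr, ih, h.resBar_twoUnit h', smul_zero, smul_zero, zero_add, zero_add]
        exact Subtype.ext (mul_zero _)

/-- Thus `1ₙ ∘ᵢ δ` is the preimage of the generator `δ_(i)` of `D_A(n)`. -/
lemma IsZeroUnit.resBar_iteratedUnit_circ {n : ℕ} (i p : Fin n) (δ : augIdeal h.augmentation) :
    h.resBar n p (P.circ (n := 1) (r := n) rfl i (iteratedUnit e₀ e₂ n) (δ : P.Unary))
      = if i = p then δ else 0 := by
  have hδ : h.aug 1 (δ : P.Unary) = 0 := δ.2
  have hslot : (slotEquiv (n := 1) (r := n) rfl i).symm (Sum.inr 0) = i := rfl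
  split_ifs with hip
  · subst hip
    refine Subtype.ext ?_
    have := h.resBar_circ_inner (n := 1) (r := n) rfl i (iteratedUnit e₀ e₂ n) (δ : P.Unary) 0
    rw [hslot, h.aug_iteratedUnit h', hδ, h.resBar_iteratedUnit h', h.resBar_unary, hδ, one_smul,
      zero_smul, zero_smul, sub_zero, add_zero] at this
    exact this.trans ((congrArg _ (zero_mul _)).trans (add_zero _))
  · refine (h.resBar_circ _ _ _ _ _).trans ?_
    rcases hs : slotEquiv (n := 1) (r := n) rfl i p with s | q
    · rw [Sum.elim_inl, hδ, zero_smul]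
    · rw [← Equiv.eq_symm_apply, Fin.fin_one_eq_zero q, hslot] at hs
      exact absurd hs.symm hip

lemma IsZeroUnit.profile_surjective (n : ℕ) : Function.Surjective (h.profile n) := by
  intro (x : k × (Fin n → augIdeal h.augmentation))
  refine ⟨x.1 • iteratedUnit e₀ e₂ n + ∑ i, P.circ (n := 1) (r := n) rfl i (iteratedUnit e₀ e₂ n)
    (x.2 i : P.Unary), Prod.ext ?_ (funext fun p => ?_)⟩
  · change h.aug n _ = x.1
    rw [map_add, map_smul, map_sum, h.aug_iteratedUnit h', smul_eq_mul, mul_one,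
      Finset.sum_eq_zero fun i _ => h.aug_iteratedUnit_circ i (x.2 i), add_zero]
  · change h.resBar n p _ = x.2 p
    rw [map_add, map_smul, map_sum, h.resBar_iteratedUnit h', smul_zero, zero_add]
    simp only [h.resBar_iteratedUnit_circ h', Finset.sum_ite_eq', Finset.mem_univ, if_true]

end TwoUnit

/-! ### Gelfand–Kirillov dimension -/

/-- For large `n`, `log_n s(n) = e + log (s(n) / n^e) / log n`, and the last numerator converges
while `log n` tends to infinity. -/
lemma tendsto_logb_of_tendsto_div_pow {s : ℕ → ℝ} {e : ℕ} {c : ℝ} (hc : 0 < c)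
    (hs : Filter.Tendsto (fun n : ℕ => s n / (n : ℝ) ^ e) Filter.atTop (nhds c)) :
    Filter.Tendsto (fun n : ℕ => Real.logb n (s n)) Filter.atTop (nhds (e : ℝ)) := by
  have hlog : Filter.Tendsto (fun n : ℕ => Real.log n) Filter.atTop Filter.atTop :=
    Real.tendsto_log_atTop.comp tendsto_natCast_atTop_atTop
  have h₁ : Filter.Tendsto (fun n : ℕ => Real.log (s n / (n : ℝ) ^ e) / Real.log n + e)
      Filter.atTop (nhds (0 + e)) :=
    ((hs.log hc.ne').div_atTop hlog).add tendsto_const_nhds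
  rw [zero_add] at h₁
  refine h₁.congr' ?_
  filter_upwards [hs.eventually_ne hc.ne', Filter.eventually_ge_atTop 2] with n hn h₂
  have hn₁ : (1 : ℝ) < n := by exact_mod_cast h₂
  have hn₀ : Real.log n ≠ 0 := (Real.log_pos hn₁).ne'
  have hpow : (n : ℝ) ^ e ≠ 0 := by positivity
  have hs₀ : s n ≠ 0 := fun h => hn (by rw [h, zero_div])
  rw [Real.log_div hs₀ hpow, Real.log_pow, Real.logb]
  field_simp
  ring

lemma gkDim_eq_of_tendsto {e : ℕ} {c : ℝ} (hc : 0 < c)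
    (hs : Filter.Tendsto (fun n : ℕ => (∑ i ∈ Finset.range (n + 1),
      (Module.finrank k (P.obj i) : ℝ)) / (n : ℝ) ^ e) Filter.atTop (nhds c)) :
    P.gkDim = ((e : ℝ) : EReal) :=
  ((continuous_coe_real_ereal.tendsto _).comp (tendsto_logb_of_tendsto_div_pow hc hs)).limsup_eq

lemma sum_dim_eq {d : ℕ} (hd : ∀ n, Module.finrank k (P.obj n) = 1 + n * d) (n : ℕ) :
    ∑ i ∈ Finset.range (n + 1), (Module.finrank k (P.obj i) : ℝ)
      = (n + 1) + d * (n * (n + 1) / 2) := by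
  induction n with
  | zero => simp [hd]
  | succ n ih =>
    rw [Finset.sum_range_succ, ih, hd]
    push_cast
    ring

lemma gkDim_eq_one (hd : ∀ n, Module.finrank k (P.obj n) = 1) : P.gkDim = 1 := by
  have h₀ := tendsto_one_div_atTop_nhds_zero_nat (𝕜 := ℝ)
  have := gkDim_eq_of_tendsto (P := P) (e := 1) (c := 1 + 0) (by norm_num) <| by
    refine (tendsto_const_nhds.add h₀).congr' ?_
    filter_upwards [Filter.eventually_gt_atTop 0] with n hn
    have : (n : ℝ) ≠ 0 := by positivity
    rw [sum_dim_eq (d := 0) (by simpa using hd)]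
    push_cast
    field_simp
    ring
  simpa using this

lemma gkDim_eq_two {d : ℕ} (hd₀ : 0 < d) (hd : ∀ n, Module.finrank k (P.obj n) = 1 + n * d) :
    P.gkDim = 2 := by
  have h₀ := tendsto_one_div_atTop_nhds_zero_nat (𝕜 := ℝ)
  have := gkDim_eq_of_tendsto (P := P) (e := 2)
    -- The quotient is `(1/n + 1/n²) + (d/2)(1 + 1/n)`; the constant is written as its termwise
    -- limit.
    (c := (0 + 0 ^ 2) + (d / 2 : ℝ) * (1 + 0)) (by positivity) <| by
    refine ((h₀.add (h₀.pow 2)).add (tendsto_const_nhds.mul (tendsto_const_nhds.add h₀))).congr' ?_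
    filter_upwards [Filter.eventually_gt_atTop 0] with n hn
    have : (n : ℝ) ≠ 0 := by positivity
    rw [sum_dim_eq hd]
    field_simp
  exact this.trans (by rw [Nat.cast_ofNat]; rfl)

end PlainOperad

namespace SymmOperad

variable {k : Type u} [Field k] {P : SymmOperad.{u, v} k} {e₀ : P.obj 0} {e₂ : P.obj 2}

open PlainOperad

/-! ### 2-unitary symmetric operads -/

/-- A 2-unitary operad whose operations are determined by their restrictions to arities zero and
one is isomorphic to `D_A`, `A = P(1)`. -/
noncomputable def profileIso (h : P.IsZeroUnit e₀) (h' : P.IsTwoUnit e₀ e₂)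
    (h₂ : lowVanish (P := P.toPlainOperad) e₀ 2 = ⊥) : Iso P (derivOperad h.augmentation) where
  equiv n := LinearEquiv.ofBijective (h.profile n)
    ⟨h.profile_injective h₂ n, h.profile_surjective h' n⟩
  map_one := h.profile_one
  map_circ hr i a b := h.profile_circ hr i a b
  map_act σ a := profile_act h σ a

/-- A 2-unitary operad as in `profileIso` is isomorphic to `Com` if `P(1) = k`. -/
noncomputable def comIso (h : P.IsZeroUnit e₀) (h' : P.IsTwoUnit e₀ e₂)
    (h₂ : lowVanish (P := P.toPlainOperad) e₀ 2 = ⊥)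
    (h₁ : Subsingleton (augIdeal h.augmentation)) : Iso P (com k) where
  equiv n := LinearEquiv.ofBijective (h.aug n)
    ⟨(injective_iff_map_eq_zero _).mpr fun _ ha => h.eq_zero_of_resBar h₂ ha fun _ =>
      congrArg Subtype.val (Subsingleton.elim _ (0 : augIdeal h.augmentation)),
    fun c => ⟨c • iteratedUnit e₀ e₂ n, by
      rw [map_smul, h.aug_iteratedUnit h', smul_eq_mul, mul_one]⟩⟩
  map_one := h.aug_one
  map_circ hr i a b := h.aug_circ hr i a b
  map_act σ a := aug_act h σ a

theorem isLocallyFinite_and_gkDim (h : P.IsZeroUnit e₀) (h' : P.IsTwoUnit e₀ e₂)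
    (h₂ : lowVanish (P := P.toPlainOperad) e₀ 2 = ⊥) [Module.Finite k P.Unary] :
    P.IsLocallyFinite ∧ (P.gkDim = 2 ∨ (P.gkDim = 1 ∧ Nonempty (Iso P (com k)))) := by
  let φ (n : ℕ) : P.obj n ≃ₗ[k] k × (Fin n → augIdeal h.augmentation) :=
    (profileIso h h' h₂).equiv n
  have hd : ∀ n, Module.finrank k (P.obj n)
      = 1 + n * Module.finrank k (augIdeal h.augmentation) := fun n => by
    rw [(φ n).finrank_eq, Module.finrank_prod, Module.finrank_self, Module.finrank_pi_fintype]
    simp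
  refine ⟨fun n => Module.Finite.equiv (φ n).symm, ?_⟩
  -- The dichotomy is whether `Ā` is zero: then only the augmentation remains and gives `Com`;
  -- otherwise the dimensions grow linearly.
  rcases Nat.eq_zero_or_pos (Module.finrank k (augIdeal h.augmentation)) with h₀ | h₀
  · refine Or.inr ⟨gkDim_eq_one fun n => ?_, ⟨comIso h h' h₂ (Module.finrank_zero_iff.mp h₀)⟩⟩
    rw [hd, h₀, mul_zero, add_zero]
  · exact Or.inl (gkDim_eq_two h₀ hd)

end SymmOperad

/-! ### The theorem for plain and symmetric operads -/

theorem theorem0p4 (k : Type u) [Field k] :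
    -- plain operads
    (∀ P : PlainOperad.{u, v} k, P.IsSemiprime → (P.IsLeftArtinian ∨ P.IsRightArtinian) →
      (P.IsReduced →
        (∀ n, n ≠ 1 → Subsingleton (P.obj n)) ∧ IsSemisimpleRing P.Unary) ∧
      (∀ e₀ : P.obj 0, P.IsZeroUnit e₀ → P.IsBoundedAbove →
        Module.finrank k (P.obj 0) = 1 ∧ (∀ n, 2 ≤ n → Subsingleton (P.obj n)) ∧
        IsSemisimpleRing P.Unary ∧ ∃ ε : P.Unary →ₐ[k] k, P.IsAugmentation e₀ ε)) ∧
    -- symmetric operads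
    (∀ P : SymmOperad.{u, v} k, P.IsSemiprime → (P.IsLeftArtinian ∨ P.IsRightArtinian) →
      (P.IsReduced →
        (∀ n, n ≠ 1 → Subsingleton (P.obj n)) ∧ IsSemisimpleRing P.Unary) ∧
      (∀ e₀ : P.obj 0, P.IsZeroUnit e₀ → P.IsBoundedAbove →
        Module.finrank k (P.obj 0) = 1 ∧ (∀ n, 2 ≤ n → Subsingleton (P.obj n)) ∧
        IsSemisimpleRing P.Unary ∧ ∃ ε : P.Unary →ₐ[k] k, P.IsAugmentation e₀ ε) ∧
      (∀ (e₀ : P.obj 0) (e₂ : P.obj 2), P.IsZeroUnit e₀ → P.IsTwoUnit e₀ e₂ →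
        IsSemisimpleRing P.Unary ∧
        (∃ ε : P.Unary →ₐ[k] k, P.IsAugmentation e₀ ε ∧
          ∃ φ : SymmOperad.Iso P (derivOperad ε),
            φ.equiv 0 e₀ = derivUnit ε 0 ∧ φ.equiv 2 e₂ = derivUnit ε 2) ∧
        (Module.Finite k P.Unary →
          P.IsLocallyFinite ∧
          (P.gkDim = 2 ∨ (P.gkDim = 1 ∧ Nonempty (SymmOperad.Iso P (SymmOperad.com k))))))) := by
  refine ⟨fun P hP hart => ?_, fun P hP hart => ?_⟩
  · have hsemi := hP.isSemiprimeFor fun _ => True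
    have hart' : P.IsLeftArtinianFor (fun _ => True) ∨ P.IsRightArtinianFor fun _ => True :=
      hart.imp (fun h => h.isLeftArtinianFor _) (fun h => h.isRightArtinianFor _)
    refine ⟨fun hred => ?_, fun e₀ he hb => ?_⟩
    · have h₁ := hred.subsingleton_of_semiprime hsemi hart' fun _ => trivial
      exact ⟨h₁, PlainOperad.isSemisimpleRing_unary_of_concentrated hsemi hart' h₁
        fun _ => trivial⟩
    · have h₂ := PlainOperad.lowVanish_two_eq_bot hsemi hart' he.2 fun _ => trivial
      exact ⟨he.finrank_eq_one,
        fun n hn => he.subsingleton_of_isBoundedAbove hsemi h₂ (fun _ => trivial) hb hn,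
        he.isSemisimpleRing_unary hsemi h₂ hart' fun _ => trivial, _, he.isAugmentation⟩
  · have hsemi := hP.isSemiprimeFor
    have hart' := hart.imp (fun h => h.isLeftArtinianFor) (fun h => h.isRightArtinianFor)
    refine ⟨fun hred => ?_, fun e₀ he hb => ?_, fun e₀ e₂ he he₂ => ?_⟩
    · have h₁ := hred.subsingleton_of_semiprime hsemi hart' P.isSubmodule_arityPart
      exact ⟨h₁, PlainOperad.isSemisimpleRing_unary_of_concentrated hsemi hart' h₁
        P.isSubmodule_unaryFamily⟩
    · have h₂ := PlainOperad.lowVanish_two_eq_bot hsemi hart' he.2 (P.isSubmodule_lowVanish e₀)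
      have hS := P.isSubmodule_resFamily he
      exact ⟨he.finrank_eq_one,
        fun n hn => he.subsingleton_of_isBoundedAbove hsemi h₂ hS hb hn,
        he.isSemisimpleRing_unary hsemi h₂ hart' hS, _, he.isAugmentation⟩
    · have h₂ := PlainOperad.lowVanish_two_eq_bot hsemi hart' he.2 (P.isSubmodule_lowVanish e₀)
      have hS := P.isSubmodule_resFamily he
      exact ⟨he.isSemisimpleRing_unary hsemi h₂ hart' hS,
        ⟨he.augmentation, he.isAugmentation, SymmOperad.profileIso he he₂ h₂,
          he.profile_zeroUnit, he.profile_twoUnit he₂⟩,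
        fun _ => SymmOperad.isLocallyFinite_and_gkDim he he₂ h₂⟩
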